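/- Setting. Let $f,g$ be probability densities with respect to a $\sigma$-finite measure $\lambda$, with Kullback–Leibler information number $\mathcal I=\int \log\frac{g}{f}\,g\,d\lambda\in(0,\infty)$. There are $K$ sensors, of which a subset $\mathcal N\subseteq[K]$ with $|\mathcal N|=K-M$, $M\ge 0$, is honest. For $\mathcal B\subseteq\mathcal N$ and $\nu\in\{0,1,\dots\}\cup\{\infty\}$ the observations $X_t^k$ ($t\ge1$, $k\in\mathcal N$) of the honest sensors are independent; $X_t^k$ has density $g$ if $k\in\mathcal B$ and $t>\nu$, and density $f$ otherwise. A strategy $\pi$ of the adversary lets the observations of the $M$ corrupt sensors at time $t$ be a measurable function $\pi_t$ of $(X^k_s : s\le t,\ k\in\mathcal N)$. Let $\mathsf P_\nu^{\mathcal B,\pi}$ be the resulting law of all observations ($\mathsf P_\infty^\pi$ for $\nu=\infty$; $\mathsf P_\infty$ when only honest sensors are involved), and let $\mathscr F_t$ be generated by the observations of all $K$ sensors up to time $t$. For an $\{\mathscr F_t\}$-stopping time $T$ put $$\mathcal J_{\mathcal B}[T]=\sup_{\nu<\infty,\,\pi}\operatorname{ess\,sup}\mathsf E_\nu^{\mathcal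 B,\pi}\big[(T-\nu)^+\mid\mathscr F_\nu\big],\qquad \mathcal A[T]=\inf_\pi \mathsf E_\infty^\pi[T],\qquad \mathcal C_\gamma=\{T:\mathcal A[T]\ge\gamma\}.$$ The local CUSUM statistic of sensor $k$ is $Y_0^k=0$, $Y_t^k=\big(Y_{t-1}^k+\log\frac{g(X_t^k)}{f(X_t^k)}\big)^+$. Let $\widetilde T_L(h)$ be the first time $t\ge1$ at which the sum of the $L$ smallest of the $K$ statistics $Y_t^k$, $k\in[K]$, is at least $h$, and let $\widetilde S_L(h)$ be the first time $t\ge1$ at which the sum of the $L$ smallest of the honest statistics $Y_t^k$, $k\in\mathcal N$, is at least $h$. Corollary (Low-Sum-CUSUM with $L=K-M$). For any $\gamma\ge1$, if $h_\gamma$ is such that $\mathsf E_\infty[\widetilde S_{K-M}(h_\gamma)]=\gamma$, then $\widetilde T_{K-M}(h_\gamma)\in\mathcal C_\gamma$. Moreover, with the same thresholds $h_\gamma$ (which do not depend on $\mathcal B$), for every affected subset $\mathcal B\subseteq\mathcal N$ with $|\mathcal B|\ge M+1$, $$\mathcal J_{\mathcal B}\big[\widetilde T_{K-M}(h_\gamma)\big]\sim\frac{\log\gamma}{(|\mathcal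 B|-M)\,\mathcal I}\qquad\text{as }\gamma\to\infty,$$ i.e. the ratio of the two sides tends to $1$ as $\gamma\to\infty$ along the levels $\gamma$ for which such a threshold exists. -/

import Mathlib

open MeasureTheory ProbabilityTheory Filter Topology Set
open scoped ENNReal NNReal

noncomputable section

/-- The known pre-change density `f` and post-change density `g` of the observations, with respect
to a σ-finite measure `ref` on the observation space. -/
structure ChangeModel (𝓧 : Type*) [MeasurableSpace 𝓧] where
  ref : Measure 𝓧
  sigmaFinite_ref : SigmaFinite ref
  f : 𝓧 → ℝ≥0
  g : 𝓧 → ℝ≥0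
  measurable_f : Measurable f
  measurable_g : Measurable g
  lintegral_f : ∫⁻ x, (f x : ℝ≥0∞) ∂ref = 1
  lintegral_g : ∫⁻ x, (g x : ℝ≥0∞) ∂ref = 1

namespace ChangeModel

variable {𝓧 : Type*} [MeasurableSpace 𝓧]

/-- The pre-change distribution of an observation. -/
def preLaw (m : ChangeModel 𝓧) : Measure 𝓧 := m.ref.withDensity fun x => (m.f x : ℝ≥0∞)

/-- The post-change distribution of an observation. -/
def postLaw (m : ChangeModel 𝓧) : Measure 𝓧 := m.ref.withDensity fun x => (m.g x : ℝ≥0∞)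

instance (m : ChangeModel 𝓧) : IsProbabilityMeasure m.preLaw :=
  ⟨by simp [preLaw, m.lintegral_f]⟩

instance (m : ChangeModel 𝓧) : IsProbabilityMeasure m.postLaw :=
  ⟨by simp [postLaw, m.lintegral_g]⟩

/-- The Kullback-Leibler information number `∫ log (g / f) g dλ`. -/
def klNumber (m : ChangeModel 𝓧) : ℝ≥0∞ := InformationTheory.klDiv m.postLaw m.preLaw

/-- The log-likelihood ratio `log (g x / f x)` of one observation; it is `-∞` where `g x = 0` and
`+∞` where `f x = 0 < g x`. -/
def logLR (m : ChangeModel 𝓧) (x : 𝓧) : EReal := ENNReal.log ((m.g x : ℝ≥0∞) / (m.f x : ℝ≥0∞))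

/-- The local CUSUM statistic at time `t` of one sensor, whose observations at the times
`1, 2, 3, …` are `x 0, x 1, x 2, …`:  `W_0 = 0` and `W_{t+1} = (W_t + ℓ_{t+1})⁺`. -/
def cusum (m : ChangeModel 𝓧) (x : ℕ → 𝓧) : ℕ → EReal
  | 0 => 0
  | t + 1 => max (m.cusum x t + m.logLR (x t)) 0

end ChangeModel

/-- The sum of the `L` smallest among the numbers `v k`: they are listed in increasing order
(with multiplicity), and the first `L` are added. -/
def lowSum {ι : Type*} [Fintype ι] (L : ℕ) (v : ι → EReal) : EReal :=
  (((Finset.univ.val.map v).sort (· ≤ ·)).take L).sum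

namespace ChangeModel

variable {𝓧 : Type*} [MeasurableSpace 𝓧]

/-- Low-Sum-CUSUM for the sensors `ι`: the first time `t ∈ {1, 2, …}` at which the sum of the `L`
smallest local CUSUM statistics is at least `h` (and `⊤` if there is none). Here `x i k` is the
observation of sensor `k` at time `i + 1`. -/
def lowSumTime (m : ChangeModel 𝓧) {ι : Type*} [Fintype ι] (L : ℕ) (h : ℝ) (x : ℕ → ι → 𝓧) : ℕ∞ :=
  ⨅ (t : ℕ) (_ : 1 ≤ t ∧ (h : EReal) ≤ lowSum L fun k => m.cusum (fun i => x i k) t), (t : ℕ∞)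

/-- The joint law of the observations of the honest sensors `N` when the change occurs at time `ν`
(`ν = ⊤`: never) in the sensors of `B`: all observations are independent, and the one of sensor `k`
at time `i + 1` has density `g` if `k ∈ B` and `ν < i + 1`, density `f` otherwise. -/
def honestLaw (m : ChangeModel 𝓧) {K : ℕ} (N B : Finset (Fin K)) (ν : ℕ∞) :
    Measure (ℕ → N → 𝓧) :=
  Measure.infinitePi fun i : ℕ => Measure.pi fun k : N =>
    if (k : Fin K) ∈ B ∧ ν < ((i + 1 : ℕ) : ℕ∞) then m.postLaw else m.preLaw

end ChangeModel

/-- The strategies of an adversary who controls the sensors outside `N`: at time `t + 1` the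
observations of the corrupt sensors are a measurable function of those of the honest sensors at the
times `1, …, t + 1`. -/
def Strategy (𝓧 : Type*) [MeasurableSpace 𝓧] {K : ℕ} (N : Finset (Fin K)) : Type _ :=
  {π : (t : ℕ) → (Fin (t + 1) → N → 𝓧) → ({k : Fin K // k ∉ N} → 𝓧) // ∀ t, Measurable (π t)}

/-- The observations of all `K` sensors, from those of the honest sensors and the strategy of the
adversary. -/
def observe {𝓧 : Type*} [MeasurableSpace 𝓧] {K : ℕ} {N : Finset (Fin K)} (π : Strategy 𝓧 N)
    (y : ℕ → N → 𝓧) : ℕ → Fin K → 𝓧 :=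
  fun t k => if hk : k ∈ N then y t ⟨k, hk⟩ else π.1 t (fun s => y s) ⟨k, hk⟩

theorem measurable_observe {𝓧 : Type*} [MeasurableSpace 𝓧] {K : ℕ} {N : Finset (Fin K)}
    (π : Strategy 𝓧 N) : Measurable (observe π) := by
  refine measurable_pi_lambda _ fun t => measurable_pi_lambda _ fun k => ?_
  by_cases hk : k ∈ N
  · simp only [observe, hk, dite_true]
    fun_prop
  · simp only [observe, hk, dite_false]
    have h1 : Measurable fun y : ℕ → N → 𝓧 => (fun s : Fin (t + 1) => y s) := by fun_prop
    exact (measurable_pi_apply _).comp ((π.2 t).comp h1)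

/-- The filtration `ℱ_t` generated by the observations of all sensors up to time `t`. -/
def obsFiltration (𝓧 : Type*) [MeasurableSpace 𝓧] (K : ℕ) :
    Filtration ℕ (inferInstance : MeasurableSpace (ℕ → Fin K → 𝓧)) where
  seq t := MeasurableSpace.comap (fun (ω : ℕ → Fin K → 𝓧) (s : Fin t) => ω s) inferInstance
  mono' := by
    intro s t hst
    have h1 : Measurable fun (z : Fin t → Fin K → 𝓧) (i : Fin s) => z (Fin.castLE hst i) := by
      fun_prop
    have h2 := MeasurableSpace.comap_mono
      (g := fun (ω : ℕ → Fin K → 𝓧) (i : Fin t) => ω i) h1.comap_le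
    rwa [MeasurableSpace.comap_comp] at h2
  le' := by
    intro t
    have h1 : Measurable fun (ω : ℕ → Fin K → 𝓧) (s : Fin t) => ω s := by fun_prop
    exact h1.comap_le

namespace ChangeModel

variable {𝓧 : Type*} [MeasurableSpace 𝓧]

/-- The joint law `P_ν^{B,π}` of the observations of all sensors. -/
def obsLaw (m : ChangeModel 𝓧) {K : ℕ} (N B : Finset (Fin K)) (π : Strategy 𝓧 N) (ν : ℕ∞) :
    Measure (ℕ → Fin K → 𝓧) :=
  (m.honestLaw N B ν).map (observe π)

/-- The worst-case detection delay `sup_{ν, π} ess sup E_ν^{B,π}[(T - ν)⁺ | ℱ_ν]`. -/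
def worstDelay (m : ChangeModel 𝓧) {K : ℕ} (N B : Finset (Fin K))
    (T : (ℕ → Fin K → 𝓧) → ℕ∞) : ℝ≥0∞ :=
  ⨆ (ν : ℕ) (π : Strategy 𝓧 N),
    essSup
      (condLExp (obsFiltration 𝓧 K ν) (m.obsLaw N B π ν) fun ω => ((T ω : ℝ≥0∞) - (ν : ℝ≥0∞)))
      (m.obsLaw N B π ν)

/-- The worst-case expected time to false alarm `inf_π E_∞^π[T]`. -/
def worstFalseAlarm (m : ChangeModel 𝓧) {K : ℕ} (N : Finset (Fin K))
    (T : (ℕ → Fin K → 𝓧) → ℕ∞) : ℝ≥0∞ :=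
  ⨅ π : Strategy 𝓧 N, ∫⁻ ω, (T ω : ℝ≥0∞) ∂(m.obsLaw N ∅ π ⊤)

/-- The class `C_γ` of detection rules (stopping times of `ℱ`) whose worst-case expected time to
false alarm is at least `γ`. -/
def ruleClass (m : ChangeModel 𝓧) {K : ℕ} (N : Finset (Fin K)) (γ : ℝ) :
    Set ((ℕ → Fin K → 𝓧) → ℕ∞) :=
  {T | IsStoppingTime (obsFiltration 𝓧 K) T ∧ ENNReal.ofReal γ ≤ m.worstFalseAlarm N T}

end ChangeModel

end

/-! Everything is done on the exponential scale `W = exp Y`, where `expCusum` takes values in `ℝ≥0∞`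
and a low-sum crossing of `h` means that every set of `L` sensors has product of `W` at least `exp
h` (`coe_le_lowSum_log_iff`). With `L = K - M = |N|`, the honest set is itself one of these sets, so
the alarm with adversary never precedes the honest one (`lowSumTime_le_lowSumTime_observe`). This is
the false alarm guarantee.

Threshold: `log γ ~ h`. Under the null law `E[lr] = 1`, and strict convexity gives `E[lr^θ] < 1 <
E[lr^(1+δ)]` for `0 < θ < 1` and `δ > 0`. The first inequality keeps the `θ`-moments of products of
the `W` bounded in time, so the mean time to false alarm is at least of order `exp (θ h)`
(`exists_exp_le_mul_lintegral_lowSumTime`). The second makes a truncated power of a single `W` grow,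
so that mean is at most of order `exp ((1+δ) h)` (`exists_lintegral_lowSumTime_le`).

Delay from above: any `K - M` sensors include at least `d = |B| - M` affected ones, so before the
alarm some affected statistic lies below `h / d`. Such a statistic has drift close to the
information number `I`, uniformly over the past, whence delay at most `h / (d c) + C` for each `c <
I` (`exists_worstDelay_le`).

Delay from below: with change time `0`, the adversary keeps its statistics at zero. The alarm
requires in particular the set omitting some `M` affected sensors to reach `h`; there only `d`
sensors drift at rate `I`, and the unaffected ones contribute arbitrarily little
(`exists_le_mul_worstDelay`).

The expected times are controlled by two discrete drift criteria, `mul_lintegral_le_of_drift_ge` and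
`le_add_mul_lintegral_of_drift_le`. Letting all auxiliary parameters tend to their limits gives
ratio `1`. -/

noncomputable section

/-! ### Sums of the smallest values -/

/-- The `i`-th entry of a sublist sits at position `i` or later in the sorted list. This is what
makes the first `L` entries a minimal choice of `L` values. -/
theorem forall₂_take_le_of_sublist {α : Type*} [LinearOrder α] :
    ∀ {l l' : List α}, l.SortedLE → l'.Sublist l → List.Forall₂ (· ≤ ·) (l.take l'.length) l'
  | _, [], _, _ => by simp
  | [], b :: l', _, h => by simp at h
  | a :: l, b :: l', hl, h => by
    have hl' := List.pairwise_cons.1 hl.pairwise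
    have h1 : l'.Sublist l := by
      cases h with
      | cons _ h => exact (List.sublist_cons_self b l').trans h
      | cons_cons _ h => exact h
    have h2 : a ≤ b := by
      rcases List.mem_cons.1 (h.subset List.mem_cons_self) with rfl | h3
      · exact le_rfl
      · exact hl'.1 b h3
    exact List.Forall₂.cons h2 (forall₂_take_le_of_sublist hl'.2.sortedLE h1)

theorem lowSum_le_sum {ι : Type*} [Fintype ι] (v : ι → EReal) (J : Finset ι) :
    lowSum J.card v ≤ ∑ k ∈ J, v k := by
  have h1 : J.val.map v ≤ (((Finset.univ.val.map v).sort (· ≤ ·) : List EReal) : Multiset EReal) := by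
    rw [Multiset.sort_eq]
    exact Multiset.map_le_map (Finset.val_le_iff.2 (Finset.subset_univ J))
  obtain ⟨l0, hl0⟩ := Quot.exists_rep (J.val.map v)
  have hl0' : (l0 : Multiset EReal) = J.val.map v := hl0
  rw [← hl0', Multiset.coe_le] at h1
  obtain ⟨l', hp, hs⟩ := h1
  have hcard : l'.length = J.card := by
    rw [hp.length_eq, ← Multiset.coe_card, hl0', Multiset.card_map, Finset.card_val]
  have h2 := (forall₂_take_le_of_sublist ((Multiset.pairwise_sort _ _).sortedLE) hs).sum_le_sum
  have h3 : l'.sum = ∑ k ∈ J, v k := by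
    rw [hp.sum_eq, ← Multiset.sum_coe, hl0', Finset.sum]
  rw [h3, hcard] at h2
  exact h2

/-- The chosen values are lifted to a sublist of an enumeration of `ι`, whose entries are distinct;
tied values therefore still come from different indices. -/
theorem exists_lowSum_eq_sum {ι : Type*} [Fintype ι] (v : ι → EReal) {L : ℕ}
    (hL : L ≤ Fintype.card ι) : ∃ J : Finset ι, J.card = L ∧ lowSum L v = ∑ k ∈ J, v k := by
  classical
  set l := (Finset.univ.val.map v).sort (· ≤ ·) with hl
  have hlen : l.length = Fintype.card ι := by
    rw [hl, Multiset.length_sort, Multiset.card_map]; rfl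
  have h1 : (l.take L).Subperm (Finset.univ.toList.map v) := by
    rw [← Multiset.coe_le, ← Multiset.map_coe, Finset.coe_toList]
    calc ((l.take L : List EReal) : Multiset EReal) ≤ (l : Multiset EReal) :=
          Multiset.coe_le.2 (List.take_sublist _ _).subperm
      _ = _ := Multiset.sort_eq _ _
  obtain ⟨l', hp, hs⟩ := h1
  obtain ⟨l'', hs', rfl⟩ := List.sublist_map_iff.1 hs
  have hnd : l''.Nodup := hs'.nodup (Finset.nodup_toList _)
  refine ⟨l''.toFinset, ?_, ?_⟩
  · rw [List.toFinset_card_of_nodup hnd, ← List.length_map (f := v), hp.length_eq,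
      List.length_take, hlen, min_eq_left hL]
  · rw [List.sum_toFinset v hnd, hp.sum_eq]; rfl

theorem sum_log_eq_log_prod {ι : Type*} (J : Finset ι) (w : ι → ℝ≥0∞) :
    ∑ k ∈ J, ENNReal.log (w k) = ENNReal.log (∏ k ∈ J, w k) := by
  classical
  induction J using Finset.induction_on with
  | empty => simp
  | insert a s ha ih => rw [Finset.sum_insert ha, Finset.prod_insert ha, ENNReal.log_mul_add, ih]

theorem coe_le_log_iff (h : ℝ) (w : ℝ≥0∞) :
    (h : EReal) ≤ ENNReal.log w ↔ ENNReal.ofReal (Real.exp h) ≤ w := by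
  rw [← EReal.exp_coe, ← EReal.log_exp (h : EReal), ENNReal.log_le_log_iff, EReal.log_exp]

/-- The low sum is the minimum of the sums over `L`-element sets. Passing to products is exact even
at infinite values, because `⊥ + ⊤ = ⊥` corresponds to `0 * ∞ = 0`. -/
theorem coe_le_lowSum_log_iff {ι : Type*} [Fintype ι] {L : ℕ} (hL : L ≤ Fintype.card ι) (h : ℝ)
    (w : ι → ℝ≥0∞) :
    (h : EReal) ≤ lowSum L (fun k => ENNReal.log (w k)) ↔
      ∀ J : Finset ι, J.card = L → ENNReal.ofReal (Real.exp h) ≤ ∏ k ∈ J, w k := by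
  constructor
  · rintro h1 J rfl
    rw [← coe_le_log_iff, ← sum_log_eq_log_prod]
    exact h1.trans (lowSum_le_sum _ J)
  · intro h1
    obtain ⟨J, hJ, hs⟩ := exists_lowSum_eq_sum (fun k => ENNReal.log (w k)) hL
    rw [hs, sum_log_eq_log_prod, coe_le_log_iff]
    exact h1 J hJ

/-! ### First times -/

theorem natCast_lt_iInf_natCast_iff (p : ℕ → Prop) (n : ℕ) :
    (n : ℕ∞) < ⨅ (t : ℕ) (_ : p t), (t : ℕ∞) ↔ ∀ t ≤ n, ¬ p t := by
  rw [← not_le]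
  constructor
  · intro h t ht hp
    exact h ((iInf₂_le t hp).trans (by exact_mod_cast ht))
  · intro h hle
    have h1 : (⨅ (t : ℕ) (_ : p t), (t : ℕ∞)) < ((n + 1 : ℕ) : ℕ∞) :=
      lt_of_le_of_lt hle (by exact_mod_cast Nat.lt_succ_self n)
    simp only [iInf_lt_iff] at h1
    obtain ⟨t, hp, ht⟩ := h1
    exact h t (by have : t < n + 1 := by exact_mod_cast ht
                  omega) hp

theorem toENNReal_eq_tsum (T : ℕ∞) :
    (T : ℝ≥0∞) = ∑' n : ℕ, if (n : ℕ∞) < T then (1 : ℝ≥0∞) else 0 := by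
  induction T using ENat.recTopCoe with
  | top => simp
  | coe m =>
    rw [tsum_eq_sum (s := Finset.range m) (fun n hn => by simpa using hn)]
    rw [Finset.sum_congr rfl (g := fun _ => (1 : ℝ≥0∞))
      (fun n hn => by simpa using hn)]
    simp

theorem toENNReal_sub_eq_tsum (T : ℕ∞) (ν : ℕ) :
    (T : ℝ≥0∞) - (ν : ℝ≥0∞) = ∑' n : ℕ, if ((ν + n : ℕ) : ℕ∞) < T then (1 : ℝ≥0∞) else 0 := by
  have h1 : (T : ℝ≥0∞) - (ν : ℝ≥0∞) = ((T - ν : ℕ∞) : ℝ≥0∞) := by simp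
  rw [h1, toENNReal_eq_tsum]
  refine tsum_congr fun n => ?_
  simp [lt_tsub_iff_left]

theorem lintegral_toENNReal_eq_tsum {Ω : Type*} [MeasurableSpace Ω] (P : Measure Ω) (T : Ω → ℕ∞)
    (hT : ∀ n : ℕ, MeasurableSet {ω | (n : ℕ∞) < T ω}) :
    ∫⁻ ω, (T ω : ℝ≥0∞) ∂P = ∑' n : ℕ, P {ω | (n : ℕ∞) < T ω} := by
  simp_rw [toENNReal_eq_tsum]
  rw [lintegral_tsum fun n => (Measurable.ite (hT n) measurable_const measurable_const).aemeasurable]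
  refine tsum_congr fun n => ?_
  rw [← lintegral_indicator_one (hT n)]
  simp [Set.indicator_apply]

theorem setLIntegral_toENNReal_sub_eq_tsum {Ω : Type*} [MeasurableSpace Ω] (P : Measure Ω)
    (T : Ω → ℕ∞) (hT : ∀ n : ℕ, MeasurableSet {ω | (n : ℕ∞) < T ω}) (A : Set Ω) (ν : ℕ) :
    ∫⁻ ω in A, ((T ω : ℝ≥0∞) - (ν : ℝ≥0∞)) ∂P
      = ∑' n : ℕ, P ({ω | ((ν + n : ℕ) : ℕ∞) < T ω} ∩ A) := by
  simp_rw [toENNReal_sub_eq_tsum]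
  rw [lintegral_tsum fun n =>
    (Measurable.ite (hT (ν + n)) measurable_const measurable_const).aemeasurable]
  refine tsum_congr fun n => ?_
  rw [← Measure.restrict_apply (hT (ν + n)), ← lintegral_indicator_one (hT (ν + n))]
  simp [Set.indicator_apply]

theorem measurable_toENNReal {Ω : Type*} [MeasurableSpace Ω] (T : Ω → ℕ∞)
    (hT : ∀ n : ℕ, MeasurableSet {ω | (n : ℕ∞) < T ω}) : Measurable fun ω => (T ω : ℝ≥0∞) := by
  simp_rw [toENNReal_eq_tsum]
  exact Measurable.tsum fun n => Measurable.ite (hT n) measurable_const measurable_const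

/-! ### The exponential of the CUSUM statistic -/

namespace ChangeModel

variable {𝓧 : Type*} [MeasurableSpace 𝓧]

/-- The likelihood ratio `g x / f x` of one observation. -/
def lr (m : ChangeModel 𝓧) (x : 𝓧) : ℝ≥0∞ := (m.g x : ℝ≥0∞) / (m.f x : ℝ≥0∞)

theorem measurable_lr (m : ChangeModel 𝓧) : Measurable m.lr :=
  m.measurable_g.coe_nnreal_ennreal.div m.measurable_f.coe_nnreal_ennreal

/-- The exponential of the local CUSUM statistic. -/
def expCusum (m : ChangeModel 𝓧) (x : ℕ → 𝓧) : ℕ → ℝ≥0∞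
  | 0 => 1
  | t + 1 => max (m.expCusum x t * m.lr (x t)) 1

theorem one_le_expCusum (m : ChangeModel 𝓧) (x : ℕ → 𝓧) (t : ℕ) : 1 ≤ m.expCusum x t := by
  cases t with
  | zero => exact le_rfl
  | succ t => exact le_max_right _ _

theorem cusum_eq_log_expCusum (m : ChangeModel 𝓧) (x : ℕ → 𝓧) (t : ℕ) :
    m.cusum x t = ENNReal.log (m.expCusum x t) := by
  induction t with
  | zero => simp [cusum, expCusum]
  | succ t ih =>
    rw [cusum, expCusum, ENNReal.log_monotone.map_max, ENNReal.log_one, ENNReal.log_mul_add, ih]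
    rfl

/-- The low-sum statistic of order `L` of the exponential CUSUM statistics `w` reaches the
threshold `h`. -/
def Crosses {ι : Type*} (L : ℕ) (h : ℝ) (w : ι → ℝ≥0∞) : Prop :=
  ∀ J : Finset ι, J.card = L → ENNReal.ofReal (Real.exp h) ≤ ∏ k ∈ J, w k

theorem measurableSet_crosses {ι : Type*} [Countable ι] (L : ℕ) (h : ℝ) :
    MeasurableSet {w : ι → ℝ≥0∞ | Crosses L h w} := by
  have h1 : {w : ι → ℝ≥0∞ | Crosses L h w}
      = ⋂ (J : Finset ι) (_ : J.card = L), {w | ENNReal.ofReal (Real.exp h) ≤ ∏ k ∈ J, w k} := by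
    ext w; simp [Crosses]
  rw [h1]
  refine MeasurableSet.iInter fun J => MeasurableSet.iInter fun _ => ?_
  exact measurableSet_le measurable_const
    (Finset.measurable_prod _ fun k _ => measurable_pi_apply k)

/-- The exponential CUSUM statistics of all sensors. -/
def expCusums {ι : Type*} (m : ChangeModel 𝓧) (x : ℕ → ι → 𝓧) (t : ℕ) : ι → ℝ≥0∞ :=
  fun k => m.expCusum (fun i => x i k) t

theorem natCast_lt_lowSumTime_iff (m : ChangeModel 𝓧) {ι : Type*} [Fintype ι] {L : ℕ}
    (hL : L ≤ Fintype.card ι) (h : ℝ) (x : ℕ → ι → 𝓧) (n : ℕ) :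
    (n : ℕ∞) < m.lowSumTime L h x ↔
      ∀ t, 1 ≤ t → t ≤ n → ¬ Crosses L h (m.expCusums x t) := by
  rw [lowSumTime, natCast_lt_iInf_natCast_iff]
  simp_rw [cusum_eq_log_expCusum, coe_le_lowSum_log_iff hL]
  constructor
  · intro H t h1 h2 h3
    exact H t h2 ⟨h1, h3⟩
  · rintro H t h2 ⟨h1, h3⟩
    exact H t h1 h2 h3

end ChangeModel

/-! ### Moments of the likelihood ratio -/

/-- Tangent line at `a = 1` (Bernoulli). With the equality case below it serves as strict Jensen for
the likelihood ratio. -/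
theorem ENNReal.rpow_le_one_sub_add_mul (a : ℝ≥0∞) {θ : ℝ} (h0 : 0 < θ) (h1 : θ < 1) :
    a ^ θ ≤ ENNReal.ofReal (1 - θ) + ENNReal.ofReal θ * a := by
  induction a using ENNReal.recTopCoe with
  | top => simp [ENNReal.mul_top, h0]
  | coe a =>
    have h2 := rpow_one_add_le_one_add_mul_self (s := (a : ℝ) - 1) (by linarith [a.coe_nonneg]) h0.le h1.le
    rw [← ENNReal.ofReal_coe_nnreal, ENNReal.ofReal_rpow_of_nonneg a.coe_nonneg h0.le,
      ← ENNReal.ofReal_mul h0.le, ← ENNReal.ofReal_add (by linarith) (mul_nonneg h0.le a.coe_nonneg)]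
    apply ENNReal.ofReal_le_ofReal
    have h3 : 1 + ((a : ℝ) - 1) = a := by ring
    rw [h3] at h2
    linarith

theorem ENNReal.eq_one_of_rpow_eq_one_sub_add_mul {a : ℝ≥0∞} (ha : a ≠ ∞) {θ : ℝ} (h0 : 0 < θ)
    (h1 : θ < 1) (h : a ^ θ = ENNReal.ofReal (1 - θ) + ENNReal.ofReal θ * a) : a = 1 := by
  lift a to ℝ≥0 using ha
  by_contra hne
  have h2 := rpow_one_add_lt_one_add_mul_self (s := (a : ℝ) - 1) (by linarith [a.coe_nonneg])
    (fun h3 => hne (by exact_mod_cast (by linarith : (a : ℝ) = 1))) h0 h1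
  rw [← ENNReal.ofReal_coe_nnreal, ENNReal.ofReal_rpow_of_nonneg a.coe_nonneg h0.le,
    ← ENNReal.ofReal_mul h0.le, ← ENNReal.ofReal_add (by linarith) (mul_nonneg h0.le a.coe_nonneg),
    ENNReal.ofReal_eq_ofReal_iff (Real.rpow_nonneg a.coe_nonneg _)
      (add_nonneg (by linarith) (mul_nonneg h0.le a.coe_nonneg))] at h
  have h3 : 1 + ((a : ℝ) - 1) = a := by ring
  rw [h3] at h2
  linarith

/-- The convex counterpart of the tangent bound, arranged as a sum on each side to avoid subtraction
in `ℝ≥0∞`. -/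
theorem ENNReal.mul_le_rpow_add (a : ℝ≥0∞) {δ : ℝ} (h0 : 0 < δ) :
    ENNReal.ofReal (1 + δ) * a ≤ a ^ (1 + δ) + ENNReal.ofReal δ := by
  induction a using ENNReal.recTopCoe with
  | top => simp [ENNReal.top_rpow_of_pos (by linarith : 0 < 1 + δ)]
  | coe a =>
    have h2 := one_add_mul_self_le_rpow_one_add (s := (a : ℝ) - 1) (by linarith [a.coe_nonneg])
      (p := 1 + δ) (by linarith)
    rw [← ENNReal.ofReal_coe_nnreal, ENNReal.ofReal_rpow_of_nonneg a.coe_nonneg (by linarith),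
      ← ENNReal.ofReal_mul (by linarith), ← ENNReal.ofReal_add (Real.rpow_nonneg a.coe_nonneg _) h0.le]
    apply ENNReal.ofReal_le_ofReal
    have h3 : 1 + ((a : ℝ) - 1) = a := by ring
    rw [h3] at h2
    linarith

theorem ENNReal.eq_one_of_mul_eq_rpow_add {a : ℝ≥0∞} (ha : a ≠ ∞) {δ : ℝ} (h0 : 0 < δ)
    (h : ENNReal.ofReal (1 + δ) * a = a ^ (1 + δ) + ENNReal.ofReal δ) : a = 1 := by
  lift a to ℝ≥0 using ha
  by_contra hne
  have h2 := one_add_mul_self_lt_rpow_one_add (s := (a : ℝ) - 1) (by linarith [a.coe_nonneg])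
    (fun h3 => hne (by exact_mod_cast (by linarith : (a : ℝ) = 1))) (p := 1 + δ) (by linarith)
  rw [← ENNReal.ofReal_coe_nnreal, ENNReal.ofReal_rpow_of_nonneg a.coe_nonneg (by linarith),
    ← ENNReal.ofReal_mul (by linarith), ← ENNReal.ofReal_add (Real.rpow_nonneg a.coe_nonneg _) h0.le,
    ENNReal.ofReal_eq_ofReal_iff (mul_nonneg (by linarith) a.coe_nonneg)
      (add_nonneg (Real.rpow_nonneg a.coe_nonneg _) h0.le)] at h
  have h3 : 1 + ((a : ℝ) - 1) = a := by ring
  rw [h3] at h2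
  linarith

/-- A dominating function, uniform in `s`, for differentiating `s ↦ E[exp (-s x)]` at `0`. For `x ≥
0` it is `1 - exp (-u) ≤ u`; for `x ≤ 0`, convexity of the exponential. -/
theorem abs_one_sub_exp_neg_mul_div_le (x : ℝ) {s : ℝ} (h0 : 0 < s) (h1 : s ≤ 1) :
    |(1 - Real.exp (-(s * x))) / s| ≤ |x| + Real.exp (-x) := by
  rw [abs_div, abs_of_pos h0, div_le_iff₀ h0]
  rcases le_total 0 x with hx | hx
  · have h2 : Real.exp (-(s * x)) ≤ 1 := Real.exp_le_one_iff.2 (by nlinarith)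
    have h3 := Real.add_one_le_exp (-(s * x))
    rw [abs_of_nonneg (by linarith), abs_of_nonneg hx]
    have := Real.exp_pos (-x)
    nlinarith
  · have h2 : 1 ≤ Real.exp (-(s * x)) := Real.one_le_exp (by nlinarith)
    rw [abs_of_nonpos (by linarith)]
    have h3 := (convexOn_exp.2 (mem_univ (0 : ℝ)) (mem_univ (-x)) (by linarith : 0 ≤ 1 - s) h0.le
      (by ring))
    simp only [smul_eq_mul, mul_zero, zero_add, Real.exp_zero, mul_one] at h3
    have h4 : s * -x = -(s * x) := by ring
    rw [h4] at h3
    have := abs_nonneg x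
    nlinarith

theorem tendsto_one_sub_exp_neg_mul_div (x : ℝ) :
    Tendsto (fun s : ℝ => (1 - Real.exp (-(s * x))) / s) (𝓝[>] 0) (𝓝 x) := by
  have h1 : HasDerivAt (fun s : ℝ => - Real.exp (-(s * x))) x 0 := by
    have h2 := (((hasDerivAt_id' (0 : ℝ)).mul_const x).fun_neg.exp).fun_neg
    simpa using h2
  have h3 := h1.tendsto_slope.mono_left (nhdsWithin_mono 0 (fun s (hs : 0 < s) => hs.ne'))
  refine h3.congr fun s => ?_
  simp [slope_def_field]
  ring

namespace ChangeModel

variable {𝓧 : Type*} [MeasurableSpace 𝓧]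

theorem postLaw_absolutelyContinuous (m : ChangeModel 𝓧) (hI : m.klNumber ≠ ∞) :
    m.postLaw ≪ m.preLaw :=
  (InformationTheory.klDiv_ne_top_iff.1 hI).1

/-- Finite information forces absolute continuity, so `g` vanishes almost everywhere on `{f = 0}`;
elsewhere `f * (g / f) = g`. -/
theorem postLaw_eq_withDensity_lr (m : ChangeModel 𝓧) (hI : m.klNumber ≠ ∞) :
    m.postLaw = m.preLaw.withDensity m.lr := by
  have hac := m.postLaw_absolutelyContinuous hI
  have hmf := m.measurable_f.coe_nnreal_ennreal
  have hmg := m.measurable_g.coe_nnreal_ennreal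
  have h0 : MeasurableSet {x | (m.f x : ℝ≥0∞) = 0} := measurableSet_eq_fun hmf measurable_const
  have h1 : m.preLaw {x | (m.f x : ℝ≥0∞) = 0} = 0 := by
    rw [preLaw, withDensity_apply _ h0]
    exact setLIntegral_eq_zero h0 fun x hx => hx
  have h2 := hac h1
  rw [postLaw, withDensity_apply _ h0, ← lintegral_indicator h0,
    lintegral_eq_zero_iff (hmg.indicator h0)] at h2
  rw [preLaw, ← withDensity_mul _ hmf m.measurable_lr, postLaw]
  refine withDensity_congr_ae ?_
  filter_upwards [h2] with x hx
  rw [Pi.mul_apply, lr]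
  by_cases hf : (m.f x : ℝ≥0∞) = 0
  · rw [indicator_of_mem (by exact hf)] at hx
    rw [hx, hf]; simp
  · rw [ENNReal.mul_div_cancel hf ENNReal.coe_ne_top]

theorem lintegral_postLaw (m : ChangeModel 𝓧) (hI : m.klNumber ≠ ∞) {u : 𝓧 → ℝ≥0∞}
    (hu : Measurable u) : ∫⁻ x, u x ∂m.postLaw = ∫⁻ x, m.lr x * u x ∂m.preLaw := by
  rw [m.postLaw_eq_withDensity_lr hI, lintegral_withDensity_eq_lintegral_mul _ m.measurable_lr hu]
  rfl

theorem lintegral_lr (m : ChangeModel 𝓧) (hI : m.klNumber ≠ ∞) : ∫⁻ x, m.lr x ∂m.preLaw = 1 := by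
  have h := m.lintegral_postLaw hI (u := fun _ => 1) measurable_const
  simpa using h.symm

theorem not_lr_ae_eq_one (m : ChangeModel 𝓧) (hI0 : 0 < m.klNumber) (hI : m.klNumber ≠ ∞) :
    ¬ m.lr =ᵐ[m.preLaw] fun _ => 1 := by
  intro h
  have h1 : m.postLaw = m.preLaw := by
    rw [m.postLaw_eq_withDensity_lr hI, withDensity_congr_ae h]
    exact withDensity_one
  rw [klNumber, h1, InformationTheory.klDiv_self] at hI0
  exact lt_irrefl _ hI0

theorem lr_ne_top_ae_preLaw (m : ChangeModel 𝓧) (hI : m.klNumber ≠ ∞) :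
    ∀ᵐ x ∂m.preLaw, m.lr x ≠ ∞ := by
  have h := ae_lt_top m.measurable_lr (by rw [m.lintegral_lr hI]; exact ENNReal.one_ne_top)
  filter_upwards [h] with x hx using hx.ne

theorem lr_ae_postLaw (m : ChangeModel 𝓧) (hI : m.klNumber ≠ ∞) :
    ∀ᵐ x ∂m.postLaw, m.lr x ≠ 0 ∧ m.lr x ≠ ∞ := by
  have h1 := (m.postLaw_absolutelyContinuous hI).ae_le (m.lr_ne_top_ae_preLaw hI)
  have h2 : ∀ᵐ x ∂m.postLaw, m.lr x ≠ 0 := by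
    have h0 : MeasurableSet {x | m.lr x = 0} := measurableSet_eq_fun m.measurable_lr measurable_const
    have h3 : m.postLaw {x | m.lr x = 0} = 0 := by
      rw [m.postLaw_eq_withDensity_lr hI, withDensity_apply _ h0]
      exact setLIntegral_eq_zero h0 fun x hx => hx
    rw [ae_iff]
    simpa using h3
  filter_upwards [h1, h2] with x hx1 hx2 using ⟨hx2, hx1⟩

theorem llr_ae_eq (m : ChangeModel 𝓧) (hI : m.klNumber ≠ ∞) :
    llr m.postLaw m.preLaw =ᵐ[m.postLaw] fun x => Real.log (m.lr x).toReal := by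
  have h1 : m.postLaw.rnDeriv m.preLaw =ᵐ[m.preLaw] m.lr := by
    have h := Measure.rnDeriv_withDensity m.preLaw m.measurable_lr
    rwa [← m.postLaw_eq_withDensity_lr hI] at h
  filter_upwards [(m.postLaw_absolutelyContinuous hI).ae_le h1] with x hx
  rw [llr, hx]

theorem integrable_log_lr (m : ChangeModel 𝓧) (hI : m.klNumber ≠ ∞) :
    Integrable (fun x => Real.log (m.lr x).toReal) m.postLaw :=
  (InformationTheory.klDiv_ne_top_iff.1 hI).2.congr (m.llr_ae_eq hI)

theorem integral_log_lr (m : ChangeModel 𝓧) (hI : m.klNumber ≠ ∞) :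
    ∫ x, Real.log (m.lr x).toReal ∂m.postLaw = m.klNumber.toReal := by
  rw [klNumber, InformationTheory.toReal_klDiv_of_measure_eq (m.postLaw_absolutelyContinuous hI)
    (by simp)]
  exact (integral_congr_ae (m.llr_ae_eq hI)).symm

/-- Gives integrability of `exp (-log lr)` after the change, hence of the dominating function above,
with no moment assumption beyond finite information. -/
theorem lintegral_inv_lr_le (m : ChangeModel 𝓧) (hI : m.klNumber ≠ ∞) :
    ∫⁻ x, (m.lr x)⁻¹ ∂m.postLaw ≤ 1 := by
  rw [m.lintegral_postLaw hI (u := fun x => (m.lr x)⁻¹) m.measurable_lr.inv]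
  calc ∫⁻ x, m.lr x * (m.lr x)⁻¹ ∂m.preLaw ≤ ∫⁻ _, 1 ∂m.preLaw :=
        lintegral_mono fun x => ENNReal.mul_inv_le_one _
    _ = 1 := by simp

theorem lr_rpow_neg_eq {a : ℝ≥0∞} (h0 : a ≠ 0) (h1 : a ≠ ∞) (s : ℝ) :
    a ^ (-s) = ENNReal.ofReal (Real.exp (-(s * Real.log a.toReal))) := by
  have h2 : 0 < a.toReal := ENNReal.toReal_pos h0 h1
  rw [← ENNReal.ofReal_toReal h1, ENNReal.ofReal_rpow_of_pos h2, Real.rpow_def_of_pos h2,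
    ENNReal.toReal_ofReal h2.le]
  congr 2
  ring

theorem integrable_exp_neg_log_lr (m : ChangeModel 𝓧) (hI : m.klNumber ≠ ∞) :
    Integrable (fun x => Real.exp (-Real.log (m.lr x).toReal)) m.postLaw := by
  refine ⟨(Real.measurable_exp.comp
    (Real.measurable_log.comp m.measurable_lr.ennreal_toReal).neg).aestronglyMeasurable, ?_⟩
  rw [hasFiniteIntegral_iff_ofReal (ae_of_all _ fun x => (Real.exp_pos _).le)]
  refine lt_of_le_of_lt (le_of_eq (lintegral_congr_ae ?_))
    ((m.lintegral_inv_lr_le hI).trans_lt ENNReal.one_lt_top)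
  filter_upwards [m.lr_ae_postLaw hI] with x hx
  have h := lr_rpow_neg_eq hx.1 hx.2 1
  rw [ENNReal.rpow_neg_one, one_mul] at h
  exact h.symm

/-- For every `c` below the Kullback-Leibler number, `E_g[(g/f)^{-s}] ≤ 1 - s c` for some `s`. -/
theorem exists_lintegral_lr_rpow_neg_le (m : ChangeModel 𝓧) (hI : m.klNumber ≠ ∞) {c : ℝ}
    (hc : c < m.klNumber.toReal) :
    ∃ s : ℝ, 0 < s ∧ s ≤ 1 ∧ ∫⁻ x, m.lr x ^ (-s) ∂m.postLaw ≤ ENNReal.ofReal (1 - s * c) := by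
  set l : 𝓧 → ℝ := fun x => Real.log (m.lr x).toReal with hl
  have hlm : Measurable l := Real.measurable_log.comp m.measurable_lr.ennreal_toReal
  have hint := m.integrable_log_lr hI
  have hexp := m.integrable_exp_neg_log_lr hI
  have hnear : ∀ᶠ s : ℝ in 𝓝[>] 0, 0 < s ∧ s ≤ 1 := Ioc_mem_nhdsGT zero_lt_one
  -- The derivative of `s ↦ E_g[exp (-s l)]` at `0` from the right is minus the information number;
  -- any `c` below that number is beaten by the difference quotient at some small `s`.
  have hlim : Tendsto (fun s : ℝ => ∫ x, (1 - Real.exp (-(s * l x))) / s ∂m.postLaw) (𝓝[>] 0)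
      (𝓝 (∫ x, l x ∂m.postLaw)) := by
    refine tendsto_integral_filter_of_dominated_convergence (fun x => |l x| + Real.exp (-l x))
      ?_ ?_ (hint.abs.add hexp) (ae_of_all _ fun x => tendsto_one_sub_exp_neg_mul_div _)
    · exact Eventually.of_forall fun s => Measurable.aestronglyMeasurable (by fun_prop)
    · filter_upwards [hnear] with s hs
      exact ae_of_all _ fun x => abs_one_sub_exp_neg_mul_div_le _ hs.1 hs.2
  rw [m.integral_log_lr hI] at hlim
  obtain ⟨s, hs, hs0, hs1⟩ := ((hlim.eventually_const_lt hc).and hnear).exists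
  refine ⟨s, hs0, hs1, ?_⟩
  have hdiv : Integrable (fun x => (1 - Real.exp (-(s * l x))) / s) m.postLaw := by
    refine Integrable.mono' (hint.abs.add hexp) (Measurable.aestronglyMeasurable (by fun_prop))
      (ae_of_all _ fun x => ?_)
    exact abs_one_sub_exp_neg_mul_div_le _ hs0 hs1
  have heq : ∀ x, Real.exp (-(s * l x)) = 1 - s * ((1 - Real.exp (-(s * l x))) / s) := by
    intro x; field_simp; ring
  have hie : Integrable (fun x => Real.exp (-(s * l x))) m.postLaw := by
    refine Integrable.congr ((integrable_const (1 : ℝ)).sub (hdiv.const_mul s))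
      (ae_of_all _ fun x => (heq x).symm)
  have h1 : ∫⁻ x, m.lr x ^ (-s) ∂m.postLaw
      = ENNReal.ofReal (∫ x, Real.exp (-(s * l x)) ∂m.postLaw) := by
    rw [ofReal_integral_eq_lintegral_ofReal hie (ae_of_all _ fun x => (Real.exp_pos _).le)]
    refine lintegral_congr_ae ?_
    filter_upwards [m.lr_ae_postLaw hI] with x hx
    exact lr_rpow_neg_eq hx.1 hx.2 s
  rw [h1]
  apply ENNReal.ofReal_le_ofReal
  rw [integral_congr_ae (ae_of_all _ heq), integral_sub (integrable_const _) (hdiv.const_mul s),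
    integral_const_mul]
  simp only [integral_const, probReal_univ, smul_eq_mul, mul_one]
  nlinarith

theorem lintegral_lr_rpow_lt_one (m : ChangeModel 𝓧) (hI0 : 0 < m.klNumber) (hI : m.klNumber ≠ ∞)
    {θ : ℝ} (h0 : 0 < θ) (h1 : θ < 1) : ∫⁻ x, m.lr x ^ θ ∂m.preLaw < 1 := by
  have hlr := m.measurable_lr
  by_contra hge
  rw [not_lt] at hge
  have h2 : ∫⁻ x, (ENNReal.ofReal (1 - θ) + ENNReal.ofReal θ * m.lr x) ∂m.preLaw = 1 := by
    rw [lintegral_add_left measurable_const, lintegral_const_mul _ hlr, m.lintegral_lr hI]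
    simp only [lintegral_const, measure_univ, mul_one]
    rw [← ENNReal.ofReal_add (by linarith) h0.le]
    simp
  have hle : (fun x => m.lr x ^ θ) ≤ᵐ[m.preLaw]
      fun x => ENNReal.ofReal (1 - θ) + ENNReal.ofReal θ * m.lr x :=
    ae_of_all _ fun x => ENNReal.rpow_le_one_sub_add_mul _ h0 h1
  have h3 := ae_eq_of_ae_le_of_lintegral_le hle
    (ne_top_of_le_ne_top ENNReal.one_ne_top ((lintegral_mono_ae hle).trans h2.le))
    (by fun_prop) (h2.le.trans hge)
  apply m.not_lr_ae_eq_one hI0 hI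
  filter_upwards [h3, m.lr_ne_top_ae_preLaw hI] with x hx hx'
  exact ENNReal.eq_one_of_rpow_eq_one_sub_add_mul hx' h0 h1 hx

theorem one_lt_lintegral_lr_rpow (m : ChangeModel 𝓧) (hI0 : 0 < m.klNumber) (hI : m.klNumber ≠ ∞)
    {δ : ℝ} (h0 : 0 < δ) : 1 < ∫⁻ x, m.lr x ^ (1 + δ) ∂m.preLaw := by
  have hlr := m.measurable_lr
  by_contra hle
  rw [not_lt] at hle
  have h2 : ∫⁻ x, (m.lr x ^ (1 + δ) + ENNReal.ofReal δ) ∂m.preLaw ≤ ENNReal.ofReal (1 + δ) := by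
    rw [lintegral_add_right _ measurable_const, ENNReal.ofReal_add zero_le_one h0.le]
    simpa using hle
  have h3 : ∫⁻ x, ENNReal.ofReal (1 + δ) * m.lr x ∂m.preLaw = ENNReal.ofReal (1 + δ) := by
    rw [lintegral_const_mul _ hlr, m.lintegral_lr hI, mul_one]
  have h4 := ae_eq_of_ae_le_of_lintegral_le
    (ae_of_all m.preLaw fun x => ENNReal.mul_le_rpow_add (m.lr x) h0)
    (by rw [h3]; exact ENNReal.ofReal_ne_top) (by fun_prop) (h2.trans h3.ge)
  apply m.not_lr_ae_eq_one hI0 hI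
  filter_upwards [h4, m.lr_ne_top_ae_preLaw hI] with x hx hx'
  exact ENNReal.eq_one_of_mul_eq_rpow_add hx' h0 hx

/-- Capping the likelihood ratio bounds the overshoot at the crossing; monotone convergence keeps
the moment above `1`. -/
theorem exists_one_lt_lintegral_min_lr_rpow (m : ChangeModel 𝓧) (hI0 : 0 < m.klNumber)
    (hI : m.klNumber ≠ ∞) {δ : ℝ} (h0 : 0 < δ) :
    ∃ C : ℕ, 1 ≤ C ∧ 1 < ∫⁻ x, min (m.lr x) C ^ (1 + δ) ∂m.preLaw := by
  have hlr := m.measurable_lr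
  have hmono : Monotone fun (n : ℕ) (x : 𝓧) => min (m.lr x) (n : ℝ≥0∞) ^ (1 + δ) := by
    intro a b hab x
    exact ENNReal.rpow_le_rpow (min_le_min le_rfl (by exact_mod_cast hab)) (by linarith)
  have h1 := m.one_lt_lintegral_lr_rpow hI0 hI h0
  have h2 : ∀ x, m.lr x ^ (1 + δ) = ⨆ n : ℕ, min (m.lr x) (n : ℝ≥0∞) ^ (1 + δ) := by
    intro x
    have h3 : m.lr x = ⨆ n : ℕ, min (m.lr x) (n : ℝ≥0∞) := by
      rw [← inf_iSup_eq, ENNReal.iSup_natCast, inf_top_eq]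
    conv_lhs => rw [h3]
    exact (ENNReal.orderIsoRpow (1 + δ) (by linarith)).map_iSup _
  simp_rw [h2] at h1
  rw [lintegral_iSup (fun n => by fun_prop) hmono, lt_iSup_iff] at h1
  obtain ⟨n, hn⟩ := h1
  exact ⟨n + 1, by omega, hn.trans_le (lintegral_mono (hmono n.le_succ))⟩

/-- Supplies the constant observation that the adversary reports to keep its statistics at zero. A
ratio above `1` everywhere could not have mean `1`. -/
theorem exists_lr_le_one (m : ChangeModel 𝓧) (hI0 : 0 < m.klNumber) (hI : m.klNumber ≠ ∞) :
    ∃ x, m.lr x ≤ 1 := by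
  by_contra! h
  refine m.not_lr_ae_eq_one hI0 hI (ae_eq_of_ae_le_of_lintegral_le (f := fun _ => 1)
    (ae_of_all _ fun x => (h x).le) (by simp) m.measurable_lr.aemeasurable ?_).symm
  rw [m.lintegral_lr hI]; simp

end ChangeModel

/-! ### One-step analysis of the exponential CUSUM statistics -/

/-- The σ-algebra generated by the first `t` observations. -/
abbrev past (S : Type*) [MeasurableSpace S] (t : ℕ) : MeasurableSpace (ℕ → S) :=
  ⨆ i ∈ Set.Iio t, MeasurableSpace.comap (fun y : ℕ → S => y i) inferInstance

section Past

variable {S : Type*} [MeasurableSpace S]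

theorem past_le (t : ℕ) : past S t ≤ MeasurableSpace.pi :=
  iSup₂_le fun i _ => (measurable_pi_apply i).comap_le

theorem past_mono {s t : ℕ} (h : s ≤ t) : past S s ≤ past S t :=
  biSup_mono fun _ hi => lt_of_lt_of_le hi h

theorem measurable_apply_past {i t : ℕ} (h : i < t) : Measurable[past S t] fun y : ℕ → S => y i :=
  measurable_iff_comap_le.2
    (le_iSup₂ (f := fun i (_ : i ∈ Set.Iio t) =>
      MeasurableSpace.comap (fun y : ℕ → S => y i) inferInstance) i h)

theorem indep_past (law : ℕ → Measure S) [∀ i, IsProbabilityMeasure (law i)] (t : ℕ) :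
    Indep (past S t) (MeasurableSpace.comap (fun y : ℕ → S => y t) inferInstance)
      (Measure.infinitePi law) := by
  have h1 : iIndepFun (fun (i : ℕ) (y : ℕ → S) => y i) (Measure.infinitePi law) :=
    iIndepFun_infinitePi (X := fun _ x => x) fun _ => measurable_id
  have h2 := indep_iSup_of_disjoint (fun i : ℕ => (measurable_pi_apply i).comap_le) h1
    (S := Set.Iio t) (T := {t}) (by simp)
  simpa [past] using h2

/-- Conditioning on the past amounts to freezing `Φ` and integrating out the new observation, by
independence and Tonelli. -/
theorem lintegral_past_prod (law : ℕ → Measure S) [∀ i, IsProbabilityMeasure (law i)] {t : ℕ}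
    {α : Type*} [MeasurableSpace α] {Φ : (ℕ → S) → α} (hΦ : Measurable[past S t] Φ)
    {u : α × S → ℝ≥0∞} (hu : Measurable u) :
    ∫⁻ y, u (Φ y, y t) ∂Measure.infinitePi law
      = ∫⁻ y, ∫⁻ x, u (Φ y, x) ∂law t ∂Measure.infinitePi law := by
  have hΦ' : Measurable Φ := hΦ.mono (past_le t) le_rfl
  have hev : Measurable fun y : ℕ → S => y t := measurable_pi_apply t
  have hind : IndepFun Φ (fun y : ℕ → S => y t) (Measure.infinitePi law) :=
    (IndepFun_iff_Indep _ _ _).2 (indep_of_indep_of_le_left (indep_past law t) hΦ.comap_le)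
  have h1 := (indepFun_iff_map_prod_eq_prod_map_map hΦ'.aemeasurable hev.aemeasurable).1 hind
  have h2 : (Measure.infinitePi law).map (fun y => y t) = law t :=
    (measurePreserving_eval_infinitePi law t).map_eq
  rw [← lintegral_map hu (hΦ'.prodMk hev), h1, h2, lintegral_prod _ hu.aemeasurable,
    lintegral_map hu.lintegral_prod_right' hΦ']

end Past

namespace ChangeModel

variable {𝓧 : Type*} [MeasurableSpace 𝓧] {ι : Type*}

theorem expCusums_succ (m : ChangeModel 𝓧) (y : ℕ → ι → 𝓧) (t : ℕ) :
    m.expCusums y (t + 1) = fun k => max (m.expCusums y t k * m.lr (y t k)) 1 := rfl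

theorem measurable_expCusums_past (m : ChangeModel 𝓧) (t : ℕ) :
    Measurable[past (ι → 𝓧) t] fun y : ℕ → ι → 𝓧 => m.expCusums y t := by
  induction t with
  | zero =>
    exact (@measurable_const _ _ _ (past (ι → 𝓧) 0) (fun _ => 1 : ι → ℝ≥0∞))
  | succ t ih =>
    refine @measurable_pi_lambda _ _ _ (past (ι → 𝓧) (t + 1)) _ _ fun k => ?_
    have h1 : Measurable[past (ι → 𝓧) (t + 1)] fun y : ℕ → ι → 𝓧 => m.expCusums y t k :=
      (measurable_pi_apply k).comp (ih.mono (past_mono t.le_succ) le_rfl)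
    have h2 : Measurable[past (ι → 𝓧) (t + 1)] fun y : ℕ → ι → 𝓧 => m.lr (y t k) :=
      (m.measurable_lr.comp (measurable_pi_apply k : Measurable fun z : ι → 𝓧 => z k)).comp
        (measurable_apply_past t.lt_succ_self)
    exact (h1.mul h2).max measurable_const

theorem measurable_expCusums (m : ChangeModel 𝓧) (t : ℕ) :
    Measurable fun y : ℕ → ι → 𝓧 => m.expCusums y t :=
  (m.measurable_expCusums_past t).mono (past_le t) le_rfl

theorem setLIntegral_expCusums_succ [Countable ι] (m : ChangeModel 𝓧) (law : ℕ → Measure (ι → 𝓧))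
    [∀ i, IsProbabilityMeasure (law i)] {t : ℕ} {A : Set (ℕ → ι → 𝓧)}
    (hA : MeasurableSet[past (ι → 𝓧) t] A) {ψ : (ι → ℝ≥0∞) → ℝ≥0∞} (hψ : Measurable ψ) :
    ∫⁻ y in A, ψ (m.expCusums y (t + 1)) ∂Measure.infinitePi law
      = ∫⁻ y in A, ∫⁻ x, ψ (fun k => max (m.expCusums y t k * m.lr (x k)) 1) ∂law t
          ∂Measure.infinitePi law := by
  classical
  have hA' : MeasurableSet A := past_le t A hA
  have hlr := m.measurable_lr
  -- The indicator of `A` is made part of the frozen past, so that the restricted integral is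
  -- covered by the unrestricted identity.
  have hΦ : Measurable[past (ι → 𝓧) t] fun y : ℕ → ι → 𝓧 =>
      (A.indicator (fun _ => (1 : ℝ≥0∞)) y, m.expCusums y t) :=
    Measurable.prodMk ((@measurable_const _ _ _ _ _).indicator hA) (m.measurable_expCusums_past t)
  have hu : Measurable fun p : (ℝ≥0∞ × (ι → ℝ≥0∞)) × (ι → 𝓧) =>
      p.1.1 * ψ (fun k => max (p.1.2 k * m.lr (p.2 k)) 1) := by fun_prop
  have h := lintegral_past_prod law hΦ hu
  simp only at h
  rw [← lintegral_indicator hA', ← lintegral_indicator hA']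
  refine Eq.trans (lintegral_congr fun y => ?_) (h.trans (lintegral_congr fun y => ?_))
  · by_cases hy : y ∈ A <;> simp [hy, expCusums_succ]
  · by_cases hy : y ∈ A <;> simp [hy]

theorem lintegral_pi_apply [Fintype ι] (κ : ι → Measure 𝓧) [∀ k, IsProbabilityMeasure (κ k)] (k : ι)
    {u : 𝓧 → ℝ≥0∞} (hu : Measurable u) :
    ∫⁻ x, u (x k) ∂Measure.pi κ = ∫⁻ x, u x ∂κ k :=
  (measurePreserving_eval κ k).lintegral_comp hu

theorem lintegral_pi_finset_prod [Fintype ι] (κ : ι → Measure 𝓧) [∀ k, IsProbabilityMeasure (κ k)]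
    (J : Finset ι) {u : ι → 𝓧 → ℝ≥0∞} (hu : ∀ k, Measurable (u k)) :
    ∫⁻ x, ∏ k ∈ J, u k (x k) ∂Measure.pi κ = ∏ k ∈ J, ∫⁻ x, u k x ∂κ k := by
  have hind : iIndepFun (fun k (x : ι → 𝓧) => u k (x k)) (Measure.pi κ) :=
    iIndepFun_pi fun k => (hu k).aemeasurable
  rw [lintegral_prod_eq_prod_lintegral_of_indepFun J _ hind
    (fun k => (hu k).comp (measurable_pi_apply k))]
  exact Finset.prod_congr rfl fun k _ => lintegral_pi_apply κ k (hu k)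

theorem setLIntegral_expCusums_apply_succ [Fintype ι] (m : ChangeModel 𝓧) (κ : ℕ → ι → Measure 𝓧)
    [∀ i k, IsProbabilityMeasure (κ i k)] {t : ℕ} {A : Set (ℕ → ι → 𝓧)}
    (hA : MeasurableSet[past (ι → 𝓧) t] A) (k : ι) {ψ : ℝ≥0∞ → ℝ≥0∞} (hψ : Measurable ψ) :
    ∫⁻ y in A, ψ (m.expCusums y (t + 1) k) ∂Measure.infinitePi (fun i => Measure.pi (κ i))
      = ∫⁻ y in A, ∫⁻ x, ψ (max (m.expCusums y t k * m.lr x) 1) ∂κ t k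
          ∂Measure.infinitePi (fun i => Measure.pi (κ i)) := by
  have hlr := m.measurable_lr
  rw [m.setLIntegral_expCusums_succ (fun i => Measure.pi (κ i)) hA
    (ψ := fun w => ψ (w k)) (hψ.comp (measurable_pi_apply k))]
  refine lintegral_congr fun y => ?_
  exact lintegral_pi_apply (κ t) k (u := fun x => ψ (max (m.expCusums y t k * m.lr x) 1))
    (by fun_prop)

end ChangeModel

/-! ### Drift criteria for expected hitting times -/

section Drift

variable {Ω : Type*} [MeasurableSpace Ω]

theorem measure_not_lt_succ (P : Measure Ω) {τ : Ω → ℕ∞}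
    (hτ : ∀ n : ℕ, MeasurableSet {ω | (n : ℕ∞) < τ ω}) (n : ℕ) :
    P {ω | (n : ℕ∞) < τ ω}ᶜ + P ({ω | (n : ℕ∞) < τ ω} \ {ω | ((n + 1 : ℕ) : ℕ∞) < τ ω})
      = P {ω | ((n + 1 : ℕ) : ℕ∞) < τ ω}ᶜ := by
  rw [← measure_union (disjoint_compl_left.mono_right sdiff_subset) ((hτ n).diff (hτ (n + 1)))]
  congr 1
  ext ω
  have h1 : ((n + 1 : ℕ) : ℕ∞) < τ ω → (n : ℕ∞) < τ ω :=
    fun h => lt_trans (by exact_mod_cast n.lt_succ_self) h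
  simp only [mem_union, mem_compl_iff, mem_ofPred_eq, Set.mem_sdiff]
  tauto

theorem setLIntegral_lt_split (P : Measure Ω) {τ : Ω → ℕ∞}
    (hτ : ∀ n : ℕ, MeasurableSet {ω | (n : ℕ∞) < τ ω}) (n : ℕ) (u : Ω → ℝ≥0∞) :
    ∫⁻ ω in {ω | (n : ℕ∞) < τ ω}, u ω ∂P
      = ∫⁻ ω in {ω | ((n + 1 : ℕ) : ℕ∞) < τ ω}, u ω ∂P
        + ∫⁻ ω in {ω | (n : ℕ∞) < τ ω} \ {ω | ((n + 1 : ℕ) : ℕ∞) < τ ω}, u ω ∂P := by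
  rw [← lintegral_inter_add_sdiff u _ (hτ (n + 1))]
  congr 3
  refine inter_eq_right.2 fun ω h => ?_
  exact lt_trans (by exact_mod_cast n.lt_succ_self : (n : ℕ∞) < ((n + 1 : ℕ) : ℕ∞)) h

/-- A potential which grows at least at rate `η` before the time `τ`, and never exceeds `H`,
bounds the expectation of `τ`. -/
theorem mul_lintegral_le_of_drift_ge (P : Measure Ω) [IsProbabilityMeasure P] {τ : Ω → ℕ∞}
    (hτ : ∀ n : ℕ, MeasurableSet {ω | (n : ℕ∞) < τ ω}) (Φ : ℕ → Ω → ℝ≥0∞) (η H : ℝ≥0∞)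
    (hΦ : ∀ n ω, Φ n ω ≤ H)
    (hdrift : ∀ n : ℕ, ∫⁻ ω in {ω | (n : ℕ∞) < τ ω}, Φ n ω ∂P + η * P {ω | (n : ℕ∞) < τ ω}
      ≤ ∫⁻ ω in {ω | (n : ℕ∞) < τ ω}, Φ (n + 1) ω ∂P) :
    η * ∫⁻ ω, (τ ω : ℝ≥0∞) ∂P ≤ H := by
  have hbd : ∀ (n : ℕ) (A : Set Ω), ∫⁻ ω in A, Φ n ω ∂P ≤ H * P A := fun n A =>
    (lintegral_mono fun ω => hΦ n ω).trans (by simp)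
  -- Optional stopping in sum form: trajectories already stopped are credited the maximal value `H`,
  -- whatever their potential was.
  have hmain : ∀ n : ℕ, η * ∑ j ∈ Finset.range n, P {ω | (j : ℕ∞) < τ ω}
      ≤ ∫⁻ ω in {ω | (n : ℕ∞) < τ ω}, Φ n ω ∂P + H * P {ω | (n : ℕ∞) < τ ω}ᶜ := by
    intro n
    induction n with
    | zero => simp
    | succ n ih =>
      rw [Finset.sum_range_succ, mul_add, ← measure_not_lt_succ P hτ n, mul_add]
      have h1 := hdrift n
      rw [setLIntegral_lt_split P hτ n (Φ (n + 1))] at h1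
      calc _ ≤ (∫⁻ ω in {ω | (n : ℕ∞) < τ ω}, Φ n ω ∂P + H * P {ω | (n : ℕ∞) < τ ω}ᶜ)
            + η * P {ω | (n : ℕ∞) < τ ω} := by gcongr
        _ = (∫⁻ ω in {ω | (n : ℕ∞) < τ ω}, Φ n ω ∂P + η * P {ω | (n : ℕ∞) < τ ω})
            + H * P {ω | (n : ℕ∞) < τ ω}ᶜ := by ring
        _ ≤ _ := add_le_add_left (h1.trans (add_le_add_right (hbd _ _) _)) _
        _ = _ := by ring
  rw [lintegral_toENNReal_eq_tsum P τ hτ, ← ENNReal.tsum_mul_left]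
  refine ENNReal.tsum_le_of_sum_range_le fun n => ?_
  rw [← Finset.mul_sum]
  calc _ ≤ _ := hmain n
    _ ≤ H * P {ω | (n : ℕ∞) < τ ω} + H * P {ω | (n : ℕ∞) < τ ω}ᶜ := by gcongr; exact hbd _ _
    _ = H := by rw [← mul_add, prob_add_prob_compl (hτ n), mul_one]

/-- A potential which grows at most at rate `a` before the time `τ`, and is at least `H` at the time
`τ`, bounds the expectation of `τ` from below. -/
theorem le_add_mul_lintegral_of_drift_le (P : Measure Ω) [IsProbabilityMeasure P] {τ : Ω → ℕ∞}
    (hτ : ∀ n : ℕ, MeasurableSet {ω | (n : ℕ∞) < τ ω}) (hτ0 : ∀ ω, 0 < τ ω) (Φ : ℕ → Ω → ℝ≥0∞)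
    {a H : ℝ≥0∞} (ha : a ≠ 0) (hH : H ≠ ∞)
    (hhit : ∀ (n : ℕ) ω, (n : ℕ∞) < τ ω → ¬ ((n + 1 : ℕ) : ℕ∞) < τ ω → H ≤ Φ (n + 1) ω)
    (hdrift : ∀ n : ℕ, ∫⁻ ω in {ω | (n : ℕ∞) < τ ω}, Φ (n + 1) ω ∂P
      ≤ ∫⁻ ω in {ω | (n : ℕ∞) < τ ω}, Φ n ω ∂P + a * P {ω | (n : ℕ∞) < τ ω}) :
    H ≤ ∫⁻ ω, Φ 0 ω ∂P + a * ∫⁻ ω, (τ ω : ℝ≥0∞) ∂P := by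
  rw [lintegral_toENNReal_eq_tsum P τ hτ]
  have huniv : {ω | ((0 : ℕ) : ℕ∞) < τ ω} = univ := eq_univ_of_forall fun ω => by simpa using hτ0 ω
  have hmain : ∀ n : ℕ, ∫⁻ ω in {ω | (n : ℕ∞) < τ ω}, Φ n ω ∂P + H * P {ω | (n : ℕ∞) < τ ω}ᶜ
      ≤ ∫⁻ ω, Φ 0 ω ∂P + a * ∑ j ∈ Finset.range n, P {ω | (j : ℕ∞) < τ ω} := by
    intro n
    induction n with
    | zero => rw [huniv]; simp
    | succ n ih =>
      have h1 := hdrift n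
      rw [setLIntegral_lt_split P hτ n (Φ (n + 1))] at h1
      have h2 : H * P ({ω | (n : ℕ∞) < τ ω} \ {ω | ((n + 1 : ℕ) : ℕ∞) < τ ω})
          ≤ ∫⁻ ω in {ω | (n : ℕ∞) < τ ω} \ {ω | ((n + 1 : ℕ) : ℕ∞) < τ ω}, Φ (n + 1) ω ∂P := by
        rw [← setLIntegral_const]
        exact setLIntegral_mono' ((hτ n).diff (hτ (n + 1))) fun ω hω => hhit n ω hω.1 hω.2
      rw [Finset.sum_range_succ, mul_add, ← measure_not_lt_succ P hτ n, mul_add]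
      calc _ = (∫⁻ ω in {ω | ((n + 1 : ℕ) : ℕ∞) < τ ω}, Φ (n + 1) ω ∂P
            + H * P ({ω | (n : ℕ∞) < τ ω} \ {ω | ((n + 1 : ℕ) : ℕ∞) < τ ω}))
            + H * P {ω | (n : ℕ∞) < τ ω}ᶜ := by ring
        _ ≤ (∫⁻ ω in {ω | (n : ℕ∞) < τ ω}, Φ n ω ∂P + a * P {ω | (n : ℕ∞) < τ ω})
            + H * P {ω | (n : ℕ∞) < τ ω}ᶜ :=
          add_le_add_left ((add_le_add_right h2 _).trans h1) _
        _ = (∫⁻ ω in {ω | (n : ℕ∞) < τ ω}, Φ n ω ∂P + H * P {ω | (n : ℕ∞) < τ ω}ᶜ)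
            + a * P {ω | (n : ℕ∞) < τ ω} := by ring
        _ ≤ _ := add_le_add_left ih _
        _ = _ := by ring
  -- Infinite expectation is trivial as `a ≠ 0`. Otherwise the tails vanish and the stopped mass,
  -- each unit worth at least `H`, tends to `1`.
  by_cases hfin : ∑' n : ℕ, P {ω | (n : ℕ∞) < τ ω} = ∞
  · rw [hfin, ENNReal.mul_top ha]; simp
  have hlim : Tendsto (fun n : ℕ => H * P {ω | (n : ℕ∞) < τ ω}ᶜ) atTop (𝓝 (H * (1 - 0))) := by
    refine ENNReal.Tendsto.const_mul ?_ (Or.inr hH)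
    have h1 := ENNReal.tendsto_atTop_zero_of_tsum_ne_top hfin
    have h2 := ENNReal.Tendsto.sub (tendsto_const_nhds (x := (1 : ℝ≥0∞))) h1
      (Or.inl ENNReal.one_ne_top)
    exact h2.congr fun n => (prob_compl_eq_one_sub (hτ n)).symm
  rw [tsub_zero, mul_one] at hlim
  refine le_of_tendsto' hlim fun n => ?_
  calc _ ≤ _ := le_add_self
    _ ≤ _ := hmain n
    _ ≤ _ := by gcongr; exact ENNReal.sum_le_tsum _

end Drift

/-! ### Expected time to false alarm -/

theorem max_one_rpow_le_one_add (a : ℝ≥0∞) (θ : ℝ) : max a 1 ^ θ ≤ 1 + a ^ θ := by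
  rcases le_total a 1 with h | h
  · rw [max_eq_right h, ENNReal.one_rpow]; exact le_self_add
  · rw [max_eq_left h]; exact le_add_self

namespace ChangeModel

variable {𝓧 : Type*} [MeasurableSpace 𝓧] {ι : Type*} [Fintype ι]

theorem measurableSet_crosses_expCusums_past (m : ChangeModel 𝓧) (L : ℕ) (h : ℝ) (t : ℕ) :
    MeasurableSet[past (ι → 𝓧) t] {y : ℕ → ι → 𝓧 | Crosses L h (m.expCusums y t)} :=
  m.measurable_expCusums_past t (measurableSet_crosses L h)

theorem measurableSet_natCast_lt_lowSumTime_past (m : ChangeModel 𝓧) {L : ℕ}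
    (hL : L ≤ Fintype.card ι) (h : ℝ) (n : ℕ) :
    MeasurableSet[past (ι → 𝓧) n] {y : ℕ → ι → 𝓧 | (n : ℕ∞) < m.lowSumTime L h y} := by
  have h1 : {y : ℕ → ι → 𝓧 | (n : ℕ∞) < m.lowSumTime L h y}
      = ⋂ (t : ℕ) (_ : 1 ≤ t) (_ : t ≤ n), {y | Crosses L h (m.expCusums y t)}ᶜ := by
    ext y
    simp [m.natCast_lt_lowSumTime_iff hL]
  rw [h1]
  refine MeasurableSet.iInter fun t => MeasurableSet.iInter fun _ => MeasurableSet.iInter fun ht =>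
    ?_
  exact (past_mono ht _ (m.measurableSet_crosses_expCusums_past L h t)).compl

theorem measurableSet_natCast_lt_lowSumTime (m : ChangeModel 𝓧) {L : ℕ}
    (hL : L ≤ Fintype.card ι) (h : ℝ) (n : ℕ) :
    MeasurableSet {y : ℕ → ι → 𝓧 | (n : ℕ∞) < m.lowSumTime L h y} :=
  past_le n _ (m.measurableSet_natCast_lt_lowSumTime_past hL h n)

theorem natCast_lt_lowSumTime_card_iff (m : ChangeModel 𝓧) (h : ℝ) (y : ℕ → ι → 𝓧) (n : ℕ) :
    (n : ℕ∞) < m.lowSumTime (Fintype.card ι) h y ↔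
      ∀ t, 1 ≤ t → t ≤ n → ∏ k, m.expCusums y t k < ENNReal.ofReal (Real.exp h) := by
  rw [m.natCast_lt_lowSumTime_iff le_rfl]
  refine forall_congr' fun t => imp_congr_right fun _ => imp_congr_right fun _ => ?_
  rw [← not_le]
  refine not_congr ⟨fun H => H Finset.univ rfl, fun H J hJ => ?_⟩
  rwa [(Finset.card_eq_iff_eq_univ J).1 hJ]

/-- The law of the observations of the sensors `ι` when no change ever occurs. -/
def nullLaw (m : ChangeModel 𝓧) (ι : Type*) [Fintype ι] : Measure (ℕ → ι → 𝓧) :=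
  Measure.infinitePi fun _ : ℕ => Measure.pi fun _ : ι => m.preLaw

instance (m : ChangeModel 𝓧) : IsProbabilityMeasure (m.nullLaw ι) := by
  unfold nullLaw; infer_instance

/-- One step replaces `W^θ` by at most `1 + ρ W^θ` in mean, with `ρ = E[lr^θ]`, and `c` is a
supersolution of this recursion. The induction runs over all `J` at once because expanding the
product brings in every subset; only independence across sensors within one step is used. -/
theorem lintegral_prod_expCusums_rpow_le (m : ChangeModel 𝓧) {θ : ℝ} (h0 : 0 < θ) {c : ℝ≥0∞}
    (hc : 1 + (∫⁻ x, m.lr x ^ θ ∂m.preLaw) * c ≤ c) (t : ℕ) (J : Finset ι) :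
    ∫⁻ y, ∏ k ∈ J, m.expCusums y t k ^ θ ∂m.nullLaw ι ≤ c ^ J.card := by
  classical
  have hlr := m.measurable_lr
  have hc1 : 1 ≤ c := le_self_add.trans hc
  induction t generalizing J with
  | zero => simpa [expCusums, expCusum] using one_le_pow₀ hc1
  | succ t ih =>
    set ρ := ∫⁻ x, m.lr x ^ θ ∂m.preLaw with hρ
    have hψ : Measurable fun w : ι → ℝ≥0∞ => ∏ k ∈ J, w k ^ θ := by fun_prop
    have hstep := m.setLIntegral_expCusums_succ
      (fun _ : ℕ => Measure.pi fun _ : ι => m.preLaw) (t := t) (A := univ)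
      (@MeasurableSet.univ _ (past (ι → 𝓧) t)) hψ
    rw [setLIntegral_univ, setLIntegral_univ] at hstep
    have hW := m.measurable_expCusums (ι := ι) t
    have hWk : ∀ k, Measurable fun y : ℕ → ι → 𝓧 => m.expCusums y t k :=
      fun k => (measurable_pi_apply k).comp hW
    calc ∫⁻ y, ∏ k ∈ J, m.expCusums y (t + 1) k ^ θ ∂m.nullLaw ι
        = _ := hstep
      _ ≤ ∫⁻ y, ∏ k ∈ J, (1 + ρ * m.expCusums y t k ^ θ) ∂m.nullLaw ι := by
          refine lintegral_mono fun y => ?_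
          calc _ ≤ ∫⁻ x : ι → 𝓧, ∏ k ∈ J, (1 + m.expCusums y t k ^ θ * m.lr (x k) ^ θ)
                ∂Measure.pi (fun _ : ι => m.preLaw) := by
                refine lintegral_mono fun x => Finset.prod_le_prod' fun k _ => ?_
                rw [← ENNReal.mul_rpow_of_nonneg _ _ h0.le]
                exact max_one_rpow_le_one_add _ θ
            _ = ∏ k ∈ J, (1 + ρ * m.expCusums y t k ^ θ) := by
                rw [lintegral_pi_finset_prod (fun _ : ι => m.preLaw) J
                  (u := fun k x => 1 + m.expCusums y t k ^ θ * m.lr x ^ θ)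
                  (fun k => by fun_prop)]
                refine Finset.prod_congr rfl fun k _ => ?_
                rw [lintegral_add_left measurable_const, lintegral_const_mul _ (by fun_prop)]
                simp [mul_comm, hρ]
      _ = ∑ J' ∈ J.powerset, ∫⁻ y, ∏ k ∈ J', ρ * m.expCusums y t k ^ θ ∂m.nullLaw ι := by
          simp_rw [Finset.prod_one_add]
          exact lintegral_finsetSum _ fun J' _ => by fun_prop
      _ ≤ ∑ J' ∈ J.powerset, ∏ k ∈ J', ρ * c := by
          refine Finset.sum_le_sum fun J' _ => ?_
          simp_rw [Finset.prod_mul_distrib, Finset.prod_const]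
          rw [lintegral_const_mul _ (by fun_prop)]
          gcongr
          exact ih J'
      _ = (1 + ρ * c) ^ J.card := by rw [← Finset.prod_one_add, Finset.prod_const]
      _ ≤ c ^ J.card := by gcongr

/-- By Markov the crossing probability at each fixed time is at most `D exp (-θ h)`; a union bound
makes an alarm unlikely for a time of order `exp (θ h)`. Here `c = 1 / (1 - ρ)` solves `1 + ρ c =
c`. -/
theorem exists_exp_le_mul_lintegral_lowSumTime (m : ChangeModel 𝓧) (hI0 : 0 < m.klNumber)
    (hI : m.klNumber ≠ ∞) (ι : Type*) [Fintype ι] {θ : ℝ} (h0 : 0 < θ) (h1 : θ < 1) :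
    ∃ D : ℝ, 0 < D ∧ ∀ h : ℝ, ENNReal.ofReal (Real.exp (θ * h)) ≤
      ENNReal.ofReal D * ∫⁻ y, (m.lowSumTime (Fintype.card ι) h y : ℝ≥0∞) ∂m.nullLaw ι := by
  set ρ := ∫⁻ x, m.lr x ^ θ ∂m.preLaw with hρ
  have hρ1 : ρ < 1 := m.lintegral_lr_rpow_lt_one hI0 hI h0 h1
  obtain ⟨r, hr, hr1⟩ : ∃ r : ℝ, ρ = ENNReal.ofReal r ∧ 0 ≤ r ∧ r < 1 := by
    refine ⟨ρ.toReal, (ENNReal.ofReal_toReal hρ1.ne_top).symm, ENNReal.toReal_nonneg, ?_⟩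
    rw [← ENNReal.toReal_one]
    exact (ENNReal.toReal_lt_toReal hρ1.ne_top ENNReal.one_ne_top).2 hρ1
  obtain ⟨hr0, hr1⟩ := hr1
  set c : ℝ := (1 - r)⁻¹ with hcdef
  have hc0 : 0 < c := inv_pos.2 (by linarith)
  have hc : 1 + ρ * ENNReal.ofReal c ≤ ENNReal.ofReal c := by
    rw [hr, ← ENNReal.ofReal_mul hr0, ← ENNReal.ofReal_one,
      ← ENNReal.ofReal_add zero_le_one (mul_nonneg hr0 hc0.le)]
    apply ENNReal.ofReal_le_ofReal
    have : (1 - r) * c = 1 := mul_inv_cancel₀ (by linarith)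
    linarith
  set D := c ^ Fintype.card ι with hD
  have hD0 : 0 < D := pow_pos hc0 _
  refine ⟨4 * D, by positivity, fun h => ?_⟩
  set P := m.nullLaw ι
  set E := Real.exp (θ * h) with hE
  have hE0 : 0 < E := Real.exp_pos _
  have hcross : ∀ t, P {y | ENNReal.ofReal (Real.exp h) ≤ ∏ k, m.expCusums y t k}
      ≤ ENNReal.ofReal (D / E) := by
    intro t
    have h2 : ∫⁻ y, ∏ k, m.expCusums y t k ^ θ ∂P ≤ ENNReal.ofReal D := by
      rw [hD, ENNReal.ofReal_pow hc0.le]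
      exact m.lintegral_prod_expCusums_rpow_le h0 hc t Finset.univ
    have hsub : {y : ℕ → ι → 𝓧 | ENNReal.ofReal (Real.exp h) ≤ ∏ k, m.expCusums y t k}
        ⊆ {y | ENNReal.ofReal E ≤ ∏ k, m.expCusums y t k ^ θ} := by
      intro y hy
      simp only [mem_ofPred_eq] at hy ⊢
      rw [ENNReal.prod_rpow_of_nonneg h0.le, hE, mul_comm, Real.exp_mul,
        ← ENNReal.ofReal_rpow_of_pos (Real.exp_pos h)]
      exact ENNReal.rpow_le_rpow hy h0.le
    have hWk : ∀ k, Measurable fun y : ℕ → ι → 𝓧 => m.expCusums y t k :=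
      fun k => (measurable_pi_apply k).comp (m.measurable_expCusums t)
    have h3 := mul_meas_ge_le_lintegral (μ := P)
      (f := fun y => ∏ k, m.expCusums y t k ^ θ) (by fun_prop) (ENNReal.ofReal E)
    rw [ENNReal.ofReal_div_of_pos hE0, ENNReal.le_div_iff_mul_le (by simp [hE0]) (by simp),
      mul_comm]
    exact ((mul_le_mul_right (measure_mono hsub) _).trans h3).trans h2
  -- The horizon at which the union bound equals `1/2`. Then the mean is at least `(n + 1) / 2 ≥ E /
  -- (4 D)`, the source of the constant `4 * D`.
  set n := ⌊E / (2 * D)⌋₊ with hn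
  have hn1 : (n : ℝ) ≤ E / (2 * D) := Nat.floor_le (by positivity)
  have hn2 : E / (2 * D) < n + 1 := Nat.lt_floor_add_one _
  have hmeas := m.measurableSet_natCast_lt_lowSumTime (ι := ι) le_rfl h
  have hle : P {y | (n : ℕ∞) < m.lowSumTime (Fintype.card ι) h y}ᶜ ≤ ENNReal.ofReal (1 / 2) := by
    have hsub : {y : ℕ → ι → 𝓧 | (n : ℕ∞) < m.lowSumTime (Fintype.card ι) h y}ᶜ
        ⊆ ⋃ t ∈ Finset.range n,
          {y | ENNReal.ofReal (Real.exp h) ≤ ∏ k, m.expCusums y (t + 1) k} := by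
      intro y hy
      simp only [mem_compl_iff, mem_ofPred_eq, m.natCast_lt_lowSumTime_card_iff, not_forall,
        not_lt] at hy
      obtain ⟨t, ht1, ht2, ht3⟩ := hy
      simp only [mem_iUnion, Finset.mem_range, exists_prop]
      refine ⟨t - 1, by omega, ?_⟩
      rw [mem_ofPred_eq, Nat.sub_add_cancel ht1]
      exact ht3
    calc _ ≤ _ := measure_mono hsub
      _ ≤ ∑ t ∈ Finset.range n, _ := measure_biUnion_finset_le _ _
      _ ≤ ∑ t ∈ Finset.range n, ENNReal.ofReal (D / E) := Finset.sum_le_sum fun t _ => hcross _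
      _ = ENNReal.ofReal (n * (D / E)) := by
          rw [Finset.sum_const, Finset.card_range, nsmul_eq_mul, ENNReal.ofReal_mul (by positivity),
            ENNReal.ofReal_natCast]
      _ ≤ _ := by
          apply ENNReal.ofReal_le_ofReal
          calc n * (D / E) ≤ E / (2 * D) * (D / E) := by gcongr
            _ = 1 / 2 := by field_simp
  have hge : ENNReal.ofReal (1 / 2) ≤ P {y | (n : ℕ∞) < m.lowSumTime (Fintype.card ι) h y} := by
    have h4 := prob_add_prob_compl (μ := P) (hmeas n)
    have h5 : (1 : ℝ≥0∞) = ENNReal.ofReal (1 / 2) + ENNReal.ofReal (1 / 2) := by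
      rw [← ENNReal.ofReal_add (by norm_num) (by norm_num)]; norm_num
    rw [h5] at h4
    by_contra hlt
    rw [not_le] at hlt
    have h6 := ENNReal.add_lt_add_of_lt_of_le
      (ne_top_of_le_ne_top ENNReal.ofReal_ne_top hle) hlt hle
    exact absurd h4 h6.ne
  have hexp : ENNReal.ofReal ((n + 1) * (1 / 2)) ≤
      ∫⁻ y, (m.lowSumTime (Fintype.card ι) h y : ℝ≥0∞) ∂P := by
    rw [lintegral_toENNReal_eq_tsum P _ hmeas]
    calc ENNReal.ofReal ((n + 1) * (1 / 2))
        = ∑ j ∈ Finset.range (n + 1), ENNReal.ofReal (1 / 2) := by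
          rw [Finset.sum_const, Finset.card_range, nsmul_eq_mul, ENNReal.ofReal_mul (by positivity)]
          congr 1
          exact_mod_cast ENNReal.ofReal_natCast (n + 1)
      _ ≤ ∑ j ∈ Finset.range (n + 1),
            P {y | (j : ℕ∞) < m.lowSumTime (Fintype.card ι) h y} := by
          refine Finset.sum_le_sum fun j hj => hge.trans (measure_mono fun y hy => ?_)
          have hjn : (j : ℕ∞) ≤ n := by
            have := Finset.mem_range.1 hj
            exact_mod_cast Nat.le_of_lt_succ this
          exact lt_of_le_of_lt hjn hy
      _ ≤ _ := ENNReal.sum_le_tsum _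
  calc ENNReal.ofReal E ≤ ENNReal.ofReal (4 * D * ((n + 1) * (1 / 2))) := by
        apply ENNReal.ofReal_le_ofReal
        rw [div_lt_iff₀ (by positivity)] at hn2
        nlinarith
    _ = ENNReal.ofReal (4 * D) * ENNReal.ofReal ((n + 1) * (1 / 2)) :=
        ENNReal.ofReal_mul (by positivity)
    _ ≤ _ := by gcongr

/-- A single sensor suffices: all factors are at least `1`, so before the alarm each one is below
`exp h`. Its truncated power gains at least `q - 1 > 0` per step. -/
theorem exists_lintegral_lowSumTime_le (m : ChangeModel 𝓧) (hI0 : 0 < m.klNumber)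
    (hI : m.klNumber ≠ ∞) (ι : Type*) [Fintype ι] [Nonempty ι] {δ : ℝ} (h0 : 0 < δ) :
    ∃ D : ℝ, 0 < D ∧ ∀ h : ℝ, 0 < h →
      ∫⁻ y, (m.lowSumTime (Fintype.card ι) h y : ℝ≥0∞) ∂m.nullLaw ι
        ≤ ENNReal.ofReal (D * Real.exp ((1 + δ) * h)) := by
  classical
  have hlr := m.measurable_lr
  obtain ⟨C, hC1, hC⟩ := m.exists_one_lt_lintegral_min_lr_rpow hI0 hI h0
  set q := ∫⁻ x, min (m.lr x) C ^ (1 + δ) ∂m.preLaw with hq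
  have hδ : 0 ≤ 1 + δ := by linarith
  have hCr : (1 : ℝ) ≤ C := by exact_mod_cast hC1
  have hqtop : q ≠ ∞ := by
    refine ne_top_of_le_ne_top (b := (C : ℝ≥0∞) ^ (1 + δ))
      (ENNReal.rpow_ne_top_of_nonneg hδ (ENNReal.natCast_ne_top C)) ?_
    calc q ≤ ∫⁻ _, (C : ℝ≥0∞) ^ (1 + δ) ∂m.preLaw :=
          lintegral_mono fun x => ENNReal.rpow_le_rpow (min_le_right _ _) hδ
      _ = _ := by simp
  have hη0 : 0 < (q - 1).toReal :=
    ENNReal.toReal_pos (tsub_pos_of_lt hC).ne' (ENNReal.sub_ne_top hqtop)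
  have hη : q - 1 = ENNReal.ofReal (q - 1).toReal :=
    (ENNReal.ofReal_toReal (ENNReal.sub_ne_top hqtop)).symm
  set η := (q - 1).toReal
  refine ⟨(C : ℝ) ^ (1 + δ) / η, by positivity, fun h hh => ?_⟩
  set P := m.nullLaw ι
  -- Before the alarm `W < exp h`, so a step with ratio capped at `C` stays below `H`; the cap on
  -- the potential costs nothing in the drift.
  set H := ENNReal.ofReal (Real.exp h * C) with hH
  set ψ : ℝ≥0∞ → ℝ≥0∞ := fun w => min w H ^ (1 + δ) with hψ
  have hψm : Measurable ψ := by fun_prop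
  let k : ι := Classical.arbitrary ι
  have hmeas := m.measurableSet_natCast_lt_lowSumTime (ι := ι) le_rfl h
  have hH1 : 1 ≤ H := by
    rw [hH, ← ENNReal.ofReal_one]
    apply ENNReal.ofReal_le_ofReal
    have := Real.one_le_exp hh.le
    nlinarith
  have hHe : ENNReal.ofReal (Real.exp h) ≤ H := by
    apply ENNReal.ofReal_le_ofReal
    have := Real.exp_pos h
    nlinarith
  have hdrift := mul_lintegral_le_of_drift_ge P hmeas (fun n y => ψ (m.expCusums y n k)) (q - 1)
    (H ^ (1 + δ)) (fun n y => ENNReal.rpow_le_rpow (min_le_right _ _) hδ) (by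
      intro n
      have hstep := m.setLIntegral_expCusums_apply_succ (fun (_ : ℕ) (_ : ι) => m.preLaw)
        (m.measurableSet_natCast_lt_lowSumTime_past (ι := ι) le_rfl h n) k hψm
      have hWk : Measurable fun y : ℕ → ι → 𝓧 => m.expCusums y n k :=
        (measurable_pi_apply k).comp (m.measurable_expCusums n)
      refine le_trans ?_ hstep.ge
      have h1 : ∫⁻ y in {y | (n : ℕ∞) < m.lowSumTime (Fintype.card ι) h y},
            ψ (m.expCusums y n k) ∂P
          + (q - 1) * P {y | (n : ℕ∞) < m.lowSumTime (Fintype.card ι) h y}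
          = ∫⁻ y in {y | (n : ℕ∞) < m.lowSumTime (Fintype.card ι) h y},
            (ψ (m.expCusums y n k) + (q - 1)) ∂P := by
        rw [lintegral_add_right _ measurable_const, setLIntegral_const]
      rw [h1]
      refine setLIntegral_mono' (hmeas n) fun y hy => ?_
      have hlt : m.expCusums y n k < ENNReal.ofReal (Real.exp h) := by
        rcases Nat.eq_zero_or_pos n with rfl | hn
        · show (1 : ℝ≥0∞) < _
          rw [← ENNReal.ofReal_one]
          exact (ENNReal.ofReal_lt_ofReal_iff (Real.exp_pos h)).2 (Real.one_lt_exp_iff.2 hh)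
        · refine lt_of_le_of_lt ?_ ((m.natCast_lt_lowSumTime_card_iff h y n).1 hy n hn le_rfl)
          exact Finset.single_le_prod' (f := fun k => m.expCusums y n k)
            (fun j _ => m.one_le_expCusum _ _) (Finset.mem_univ k)
      have hW1 : 1 ≤ m.expCusums y n k := m.one_le_expCusum _ _
      generalize m.expCusums y n k = w at hlt hW1
      have hψw : ψ w = w ^ (1 + δ) := by
        simp only [hψ]; rw [min_eq_left (hlt.le.trans hHe)]
      have h1ψ : 1 ≤ ψ w := by rw [hψw]; exact ENNReal.one_le_rpow hW1 (by linarith)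
      calc ψ w + (q - 1) ≤ ψ w + (q - 1) * ψ w := by
            gcongr; exact le_mul_of_one_le_right' h1ψ
        _ = q * ψ w := by
            rw [← one_add_mul, add_tsub_cancel_of_le hC.le]
        _ = ∫⁻ x, ψ w * min (m.lr x) C ^ (1 + δ) ∂m.preLaw := by
            rw [lintegral_const_mul _ (by fun_prop), mul_comm]
        _ ≤ ∫⁻ x, ψ (max (w * m.lr x) 1) ∂m.preLaw := by
            refine lintegral_mono fun x => ?_
            rw [hψw, ← ENNReal.mul_rpow_of_nonneg _ _ hδ]
            refine ENNReal.rpow_le_rpow (le_min ?_ ?_) hδ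
            · exact le_max_of_le_left (by gcongr; exact min_le_left _ _)
            · rw [hH, ENNReal.ofReal_mul (Real.exp_pos h).le, ENNReal.ofReal_natCast]
              exact mul_le_mul' hlt.le (min_le_right _ _))
  rw [hη, hH, ENNReal.ofReal_rpow_of_pos (by positivity)] at hdrift
  have h2 : (Real.exp h * C) ^ (1 + δ) = η * ((C : ℝ) ^ (1 + δ) / η * Real.exp ((1 + δ) * h)) := by
    rw [Real.mul_rpow (Real.exp_pos h).le (by positivity), ← Real.exp_mul, mul_comm h]
    field_simp
  rw [h2, ENNReal.ofReal_mul hη0.le] at hdrift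
  exact (ENNReal.mul_le_mul_iff_right (by simp [hη0]) ENNReal.ofReal_ne_top).1 hdrift

theorem lintegral_lowSumTime_le_one (m : ChangeModel 𝓧) (ι : Type*) [Fintype ι] {h : ℝ}
    (hh : h ≤ 0) : ∫⁻ y, (m.lowSumTime (Fintype.card ι) h y : ℝ≥0∞) ∂m.nullLaw ι ≤ 1 := by
  have h1 : ∀ y : ℕ → ι → 𝓧, (m.lowSumTime (Fintype.card ι) h y : ℝ≥0∞) ≤ 1 := by
    intro y
    have h2 : m.lowSumTime (Fintype.card ι) h y ≤ ((1 : ℕ) : ℕ∞) := by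
      rw [← not_lt, m.natCast_lt_lowSumTime_card_iff]
      push Not
      refine ⟨1, le_rfl, le_rfl, ?_⟩
      calc ENNReal.ofReal (Real.exp h) ≤ 1 := by
            rw [← ENNReal.ofReal_one]
            exact ENNReal.ofReal_le_ofReal (Real.exp_le_one_iff.2 hh)
        _ ≤ _ := Finset.one_le_prod' fun k _ => m.one_le_expCusum _ _
    exact_mod_cast h2
  calc _ ≤ ∫⁻ _, 1 ∂m.nullLaw ι := lintegral_mono h1
    _ = 1 := by simp

end ChangeModel

/-! ### Upper bound for the detection delay -/

theorem max_one_rpow_neg_le {w r : ℝ≥0∞} (hw : 1 ≤ w) (hr : r ≠ 0) {s : ℝ} (hs : 0 ≤ s) :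
    max (w * r) 1 ^ (-s) ≤ w ^ (-s) * r ^ (-s) := by
  rw [← ENNReal.mul_rpow_of_ne_zero (zero_lt_one.trans_le hw).ne' hr, ENNReal.rpow_neg,
    ENNReal.rpow_neg, ENNReal.inv_le_inv]
  exact ENNReal.rpow_le_rpow (le_max_left _ _) hs

namespace ChangeModel

variable {𝓧 : Type*} [MeasurableSpace 𝓧] {ι : Type*} [Fintype ι]

theorem lintegral_max_one_rpow_neg_le (m : ChangeModel 𝓧) (hI : m.klNumber ≠ ∞) {w : ℝ≥0∞}
    (hw : 1 ≤ w) {s : ℝ} (hs : 0 ≤ s) :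
    ∫⁻ x, max (w * m.lr x) 1 ^ (-s) ∂m.postLaw
      ≤ (∫⁻ x, m.lr x ^ (-s) ∂m.postLaw) * w ^ (-s) := by
  have hlr := m.measurable_lr
  rw [mul_comm, ← lintegral_const_mul _ (by fun_prop)]
  refine lintegral_mono_ae ?_
  filter_upwards [m.lr_ae_postLaw hI] with x hx
  exact max_one_rpow_neg_le hw hx.1 hs

/-- At the change time `W^(-s) ≤ 1` whatever the past, and reflection at `1` only decreases
`W^(-s)`. Hence geometric contraction on every past event `A`. -/
theorem setLIntegral_expCusums_rpow_neg_le (m : ChangeModel 𝓧) (hI : m.klNumber ≠ ∞)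
    (κ : ℕ → ι → Measure 𝓧) [∀ i k, IsProbabilityMeasure (κ i k)] {ν : ℕ} {k : ι}
    (hκ : ∀ i, ν ≤ i → κ i k = m.postLaw) {A : Set (ℕ → ι → 𝓧)}
    (hA : MeasurableSet[past (ι → 𝓧) ν] A) {s : ℝ} (hs : 0 < s) (n : ℕ) :
    ∫⁻ y in A, m.expCusums y (ν + n) k ^ (-s) ∂Measure.infinitePi (fun i => Measure.pi (κ i))
      ≤ (∫⁻ x, m.lr x ^ (-s) ∂m.postLaw) ^ n
        * Measure.infinitePi (fun i => Measure.pi (κ i)) A := by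
  induction n with
  | zero =>
    rw [pow_zero, one_mul, ← setLIntegral_one]
    refine lintegral_mono fun y => ?_
    rw [ENNReal.rpow_neg]
    exact ENNReal.inv_le_one.2 (ENNReal.one_le_rpow (m.one_le_expCusum _ _) hs)
  | succ n ih =>
    have hψ : Measurable fun w : ℝ≥0∞ => w ^ (-s) := by fun_prop
    have hWk : Measurable fun y : ℕ → ι → 𝓧 => m.expCusums y (ν + n) k :=
      (measurable_pi_apply k).comp (m.measurable_expCusums (ν + n))
    rw [← add_assoc, m.setLIntegral_expCusums_apply_succ κ
      (past_mono (ν.le_add_right n) _ hA) k hψ, hκ (ν + n) (ν.le_add_right n)]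
    calc _ ≤ ∫⁻ y in A, (∫⁻ x, m.lr x ^ (-s) ∂m.postLaw) * m.expCusums y (ν + n) k ^ (-s)
          ∂Measure.infinitePi (fun i => Measure.pi (κ i)) :=
        lintegral_mono fun y => m.lintegral_max_one_rpow_neg_le hI (m.one_le_expCusum _ _) hs.le
      _ = (∫⁻ x, m.lr x ^ (-s) ∂m.postLaw) * ∫⁻ y in A, m.expCusums y (ν + n) k ^ (-s)
          ∂Measure.infinitePi (fun i => Measure.pi (κ i)) := lintegral_const_mul _ (by fun_prop)
      _ ≤ _ := by rw [pow_succ', mul_assoc]; gcongr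

theorem measure_expCusums_lt_inter_le (m : ChangeModel 𝓧) (hI : m.klNumber ≠ ∞)
    (κ : ℕ → ι → Measure 𝓧) [∀ i k, IsProbabilityMeasure (κ i k)] {ν : ℕ} {k : ι}
    (hκ : ∀ i, ν ≤ i → κ i k = m.postLaw) {A : Set (ℕ → ι → 𝓧)}
    (hA : MeasurableSet[past (ι → 𝓧) ν] A) {s : ℝ} (hs : 0 < s) (b : ℝ) (n : ℕ) :
    Measure.infinitePi (fun i => Measure.pi (κ i))
        ({y | m.expCusums y (ν + n) k < ENNReal.ofReal (Real.exp b)} ∩ A)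
      ≤ ENNReal.ofReal (Real.exp (s * b)) * (∫⁻ x, m.lr x ^ (-s) ∂m.postLaw) ^ n
        * Measure.infinitePi (fun i => Measure.pi (κ i)) A := by
  set P := Measure.infinitePi (fun i => Measure.pi (κ i))
  have hWk : Measurable fun y : ℕ → ι → 𝓧 => m.expCusums y (ν + n) k :=
    (measurable_pi_apply k).comp (m.measurable_expCusums (ν + n))
  have hset : MeasurableSet {y : ℕ → ι → 𝓧 |
      m.expCusums y (ν + n) k < ENNReal.ofReal (Real.exp b)} :=
    measurableSet_lt hWk measurable_const
  have h1 := m.setLIntegral_expCusums_rpow_neg_le hI κ hκ hA hs n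
  have h2 := mul_meas_ge_le_lintegral (μ := P.restrict A)
    (f := fun y => m.expCusums y (ν + n) k ^ (-s)) (by fun_prop)
    (ENNReal.ofReal (Real.exp (s * b)))⁻¹
  have hsub : {y : ℕ → ι → 𝓧 | m.expCusums y (ν + n) k < ENNReal.ofReal (Real.exp b)}
      ⊆ {y | (ENNReal.ofReal (Real.exp (s * b)))⁻¹ ≤ m.expCusums y (ν + n) k ^ (-s)} := by
    intro y hy
    simp only [mem_ofPred_eq] at hy ⊢
    rw [ENNReal.rpow_neg, ENNReal.inv_le_inv, mul_comm, Real.exp_mul,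
      ← ENNReal.ofReal_rpow_of_pos (Real.exp_pos b)]
    exact ENNReal.rpow_le_rpow hy.le hs.le
  rw [← Measure.restrict_apply hset, mul_assoc]
  have h3 := ((mul_le_mul_right (measure_mono hsub) _).trans h2).trans h1
  rwa [mul_comm, ← div_eq_mul_inv,
    ENNReal.div_le_iff_le_mul (Or.inl (by simp [Real.exp_pos])) (Or.inl (by simp)), mul_comm] at h3

/-- The constant depends only on `c` and the bound `r` on the number of sensors. This uniformity in
`ν`, `A` and `τ` is what handles the suprema over change times and strategies and the essential
supremum. -/
theorem exists_setLIntegral_delay_le (m : ChangeModel 𝓧) (hI : m.klNumber ≠ ∞) {c : ℝ}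
    (hc0 : 0 < c) (hc : c < m.klNumber.toReal) (r : ℕ) :
    ∃ C : ℝ, 0 ≤ C ∧ ∀ (ι : Type) [Fintype ι] (κ : ℕ → ι → Measure 𝓧)
      [∀ i k, IsProbabilityMeasure (κ i k)] (B : Finset ι) (ν : ℕ) (b : ℝ)
      (τ : (ℕ → ι → 𝓧) → ℕ∞) (A : Set (ℕ → ι → 𝓧)), B.card ≤ r →
      (∀ i, ν ≤ i → ∀ k ∈ B, κ i k = m.postLaw) → 0 ≤ b →
      (∀ n : ℕ, MeasurableSet {y | (n : ℕ∞) < τ y}) → MeasurableSet[past (ι → 𝓧) ν] A →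
      (∀ n : ℕ, 1 ≤ n → ∀ y, ((ν + n : ℕ) : ℕ∞) < τ y →
        ∃ k ∈ B, m.expCusums y (ν + n) k < ENNReal.ofReal (Real.exp b)) →
      ∫⁻ y in A, ((τ y : ℝ≥0∞) - (ν : ℝ≥0∞)) ∂Measure.infinitePi (fun i => Measure.pi (κ i))
        ≤ ENNReal.ofReal (b / c + C) * Measure.infinitePi (fun i => Measure.pi (κ i)) A := by
  obtain ⟨s, hs0, hs1, hφ⟩ := m.exists_lintegral_lr_rpow_neg_le hI hc
  set φ := ∫⁻ x, m.lr x ^ (-s) ∂m.postLaw with hφdef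
  set q := Real.exp (-(s * c)) with hq
  have hq0 : 0 < q := Real.exp_pos _
  have hq1 : q < 1 := Real.exp_lt_one_iff.2 (by nlinarith)
  have hφq : φ ≤ ENNReal.ofReal q := hφ.trans (ENNReal.ofReal_le_ofReal (by
    have := Real.add_one_le_exp (-(s * c)); linarith))
  have h1q : 0 < 1 - q := by linarith
  refine ⟨2 + r * (1 - q)⁻¹, by positivity, ?_⟩
  intro ι _ κ _ B ν b τ A hBr hκ hb hτ hA hcov
  set P := Measure.infinitePi (fun i => Measure.pi (κ i))
  -- After `b / c` steps the contraction absorbs the Markov factor `exp (s b)`, leaving a geometric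
  -- tail. The extra `1` ensures `n ≥ 1`, since the rule is not tested at time `0`.
  set n0 := ⌈b / c⌉₊ + 1 with hn0
  have hn01 : (n0 : ℝ) ≤ b / c + 2 := by
    have := (Nat.ceil_lt_add_one (div_nonneg hb hc0.le)).le
    rw [hn0]; push_cast; linarith
  have hn02 : b / c ≤ n0 := by
    have := Nat.le_ceil (b / c)
    rw [hn0]; push_cast; linarith
  have hexp : Real.exp (s * b) * q ^ n0 ≤ 1 := by
    rw [hq, ← Real.exp_nat_mul, ← Real.exp_add]
    apply Real.exp_le_one_iff.2
    rw [div_le_iff₀ hc0] at hn02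
    nlinarith
  rw [setLIntegral_toENNReal_sub_eq_tsum P τ hτ A ν,
    ← Summable.sum_add_tsum_nat_add' (k := n0) ENNReal.summable]
  have hfirst : ∑ n ∈ Finset.range n0, P ({y | ((ν + n : ℕ) : ℕ∞) < τ y} ∩ A)
      ≤ ENNReal.ofReal n0 * P A := by
    calc _ ≤ ∑ n ∈ Finset.range n0, P A :=
          Finset.sum_le_sum fun n _ => measure_mono inter_subset_right
      _ = _ := by simp
  have hterm : ∀ n : ℕ, P ({y | ((ν + (n + n0) : ℕ) : ℕ∞) < τ y} ∩ A)
      ≤ (r * P A) * ENNReal.ofReal q ^ n := by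
    intro n
    have hsub : {y | ((ν + (n + n0) : ℕ) : ℕ∞) < τ y} ∩ A ⊆ ⋃ k ∈ B,
        ({y | m.expCusums y (ν + (n + n0)) k < ENNReal.ofReal (Real.exp b)} ∩ A) := by
      rintro y ⟨hy, hyA⟩
      obtain ⟨k, hk, hlt⟩ := hcov (n + n0) (by omega) y hy
      simp only [mem_iUnion]
      exact ⟨k, hk, hlt, hyA⟩
    calc _ ≤ _ := measure_mono hsub
      _ ≤ ∑ k ∈ B, _ := measure_biUnion_finset_le _ _
      _ ≤ ∑ k ∈ B, ENNReal.ofReal q ^ n * P A := by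
          refine Finset.sum_le_sum fun k hk => ?_
          refine (m.measure_expCusums_lt_inter_le hI κ (fun i hi => hκ i hi k hk) hA hs0 b
            (n + n0)).trans ?_
          gcongr
          rw [← hφdef]
          calc ENNReal.ofReal (Real.exp (s * b)) * φ ^ (n + n0)
              ≤ ENNReal.ofReal (Real.exp (s * b)) * ENNReal.ofReal q ^ (n + n0) := by gcongr
            _ = ENNReal.ofReal q ^ n * ENNReal.ofReal (Real.exp (s * b) * q ^ n0) := by
                rw [ENNReal.ofReal_mul (Real.exp_pos _).le, ENNReal.ofReal_pow hq0.le, pow_add]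
                ring
            _ ≤ ENNReal.ofReal q ^ n * 1 := by
                gcongr
                rw [← ENNReal.ofReal_one]
                exact ENNReal.ofReal_le_ofReal hexp
            _ = _ := mul_one _
      _ = B.card * (ENNReal.ofReal q ^ n * P A) := by rw [Finset.sum_const, nsmul_eq_mul]
      _ ≤ r * (ENNReal.ofReal q ^ n * P A) := by gcongr
      _ = _ := by ring
  have hsecond : ∑' n : ℕ, P ({y | ((ν + (n + n0) : ℕ) : ℕ∞) < τ y} ∩ A)
      ≤ ENNReal.ofReal (r * (1 - q)⁻¹) * P A := by
    calc _ ≤ _ := ENNReal.tsum_le_tsum hterm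
      _ = (r * P A) * (1 - ENNReal.ofReal q)⁻¹ := by
          rw [ENNReal.tsum_mul_left, ENNReal.tsum_geometric]
      _ = _ := by
          rw [ENNReal.ofReal_mul (by positivity), ENNReal.ofReal_natCast,
            ENNReal.ofReal_inv_of_pos h1q, ENNReal.ofReal_sub _ hq0.le, ENNReal.ofReal_one]
          ring
  calc _ ≤ _ := add_le_add hfirst hsecond
    _ = ENNReal.ofReal (n0 + r * (1 - q)⁻¹) * P A := by
        rw [← add_mul, ENNReal.ofReal_add (by positivity) (by positivity)]
    _ ≤ _ := mul_le_mul_left (ENNReal.ofReal_le_ofReal (by linarith)) _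

/-! ### Drifts for the lower bound of the detection delay -/

/-- The positive part of the logarithm. -/
def posLog (w : ℝ≥0∞) : ℝ≥0∞ := (ENNReal.log w).toENNReal

theorem measurable_posLog : Measurable posLog := ENNReal.measurable_log.ereal_toENNReal

theorem posLog_mono {v w : ℝ≥0∞} (h : v ≤ w) : posLog v ≤ posLog w :=
  EReal.toENNReal_le_toENNReal (ENNReal.log_monotone h)

theorem posLog_one : posLog 1 = 0 := by simp [posLog]

theorem posLog_max_one (w : ℝ≥0∞) : posLog (max w 1) = posLog w := by
  rcases le_total w 1 with h | h
  · rw [max_eq_right h, posLog_one, eq_comm, posLog, EReal.toENNReal_eq_zero_iff]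
    simpa using h
  · rw [max_eq_left h]

theorem posLog_of_ne {w : ℝ≥0∞} (h0 : w ≠ 0) (h1 : w ≠ ∞) :
    posLog w = ENNReal.ofReal (Real.log w.toReal) := by
  rw [posLog, ENNReal.log_pos_real h0 h1]; rfl

theorem posLog_ofReal_exp (h : ℝ) : posLog (ENNReal.ofReal (Real.exp h)) = ENNReal.ofReal h := by
  rw [posLog, ENNReal.log_ofReal_of_pos (Real.exp_pos h), Real.log_exp]; rfl

theorem posLog_prod_le {α : Type*} (J : Finset α) (w : α → ℝ≥0∞) :
    posLog (∏ k ∈ J, w k) ≤ ∑ k ∈ J, posLog (w k) := by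
  classical
  induction J using Finset.induction_on with
  | empty => simp [posLog_one]
  | insert a s ha ih =>
    rw [Finset.prod_insert ha, Finset.sum_insert ha]
    calc posLog (w a * ∏ k ∈ s, w k) ≤ posLog (w a) + posLog (∏ k ∈ s, w k) := by
          rw [posLog, ENNReal.log_mul_add]; exact EReal.toENNReal_add_le
      _ ≤ _ := by gcongr

/-- Replaces the statistic of an unaffected sensor by `ε W`, whose mean grows by at most `ε` per
step, at the price of an additive constant. -/
theorem posLog_le_mul_add {w : ℝ≥0∞} (hw : 1 ≤ w) {ε : ℝ} (hε : 0 < ε) :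
    posLog w ≤ ENNReal.ofReal ε * w + ENNReal.ofReal |Real.log ε| := by
  by_cases h1 : w = ∞
  · rw [h1, ENNReal.mul_top (by simpa using hε)]; simp
  · have h0 := (zero_lt_one.trans_le hw).ne'
    have hpos := ENNReal.toReal_pos h0 h1
    rw [posLog_of_ne h0 h1]
    conv_rhs => rw [← ENNReal.ofReal_toReal h1]
    rw [← ENNReal.ofReal_mul hε.le, ← ENNReal.ofReal_add (by positivity) (abs_nonneg _)]
    apply ENNReal.ofReal_le_ofReal
    have h2 := Real.log_le_sub_one_of_pos (mul_pos hε hpos)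
    rw [Real.log_mul hε.ne' hpos.ne'] at h2
    have := neg_abs_le (Real.log ε)
    linarith

/-- Since `u⁺ = u + u⁻`, the drift exceeds the information number only by the mean of `u⁻`, and `u⁻
≤ exp (-s u) / s`. -/
theorem lintegral_posLog_max_one_le (m : ChangeModel 𝓧) (hI : m.klNumber ≠ ∞) {w : ℝ≥0∞}
    (hw : 1 ≤ w) {s : ℝ} (hs : 0 < s) :
    ∫⁻ x, posLog (max (w * m.lr x) 1) ∂m.postLaw
      ≤ posLog w + m.klNumber
        + ENNReal.ofReal s⁻¹ * ((∫⁻ x, m.lr x ^ (-s) ∂m.postLaw) * w ^ (-s)) := by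
  have hlr := m.measurable_lr
  by_cases h1 : w = ∞
  · simp [h1, posLog]
  have h0 := (zero_lt_one.trans_le hw).ne'
  have hpos := ENNReal.toReal_pos h0 h1
  have hw1 : 1 ≤ w.toReal := by
    rw [← ENNReal.toReal_one]; exact (ENNReal.toReal_le_toReal ENNReal.one_ne_top h1).2 hw
  set l : 𝓧 → ℝ := fun x => Real.log (m.lr x).toReal
  set u : 𝓧 → ℝ := fun x => Real.log w.toReal + l x with hu
  have hint : Integrable l m.postLaw := m.integrable_log_lr hI
  have huint : Integrable u m.postLaw := (integrable_const _).add hint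
  have hmul : ∀ x, m.lr x ≠ 0 → m.lr x ≠ ∞ → Real.log (w * m.lr x).toReal = u x := by
    intro x hx0 hx1
    rw [ENNReal.toReal_mul, Real.log_mul hpos.ne' (ENNReal.toReal_pos hx0 hx1).ne']
  have h2 : ∫⁻ x, posLog (max (w * m.lr x) 1) ∂m.postLaw
      = ENNReal.ofReal (∫ x, max (u x) 0 ∂m.postLaw) := by
    rw [ofReal_integral_eq_lintegral_ofReal huint.pos_part (ae_of_all _ fun x => le_max_right _ _)]
    refine lintegral_congr_ae ?_
    filter_upwards [m.lr_ae_postLaw hI] with x hx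
    rw [posLog_max_one, posLog_of_ne (mul_ne_zero h0 hx.1) (ENNReal.mul_ne_top h1 hx.2),
      hmul x hx.1 hx.2, ENNReal.ofReal_max, ENNReal.ofReal_zero, max_eq_left zero_le]
  have h3 : ∫ x, max (u x) 0 ∂m.postLaw
      = (Real.log w.toReal + m.klNumber.toReal) + ∫ x, max (-u x) 0 ∂m.postLaw := by
    have h4 : ∫ x, u x ∂m.postLaw = Real.log w.toReal + m.klNumber.toReal := by
      rw [hu, integral_add (integrable_const _) hint, ← m.integral_log_lr hI]
      simp [l]
    rw [← h4, ← integral_add huint huint.neg_part]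
    refine integral_congr_ae (ae_of_all _ fun x => ?_)
    show max (u x) 0 = u x + max (-u x) 0
    rcases le_total (u x) 0 with h | h
    · rw [max_eq_right h, max_eq_left (by linarith)]; ring
    · rw [max_eq_left h, max_eq_right (by linarith)]; ring
  have h5 : ENNReal.ofReal (∫ x, max (-u x) 0 ∂m.postLaw)
      ≤ ENNReal.ofReal s⁻¹ * ((∫⁻ x, m.lr x ^ (-s) ∂m.postLaw) * w ^ (-s)) := by
    rw [ofReal_integral_eq_lintegral_ofReal huint.neg_part
      (ae_of_all _ fun x => le_max_right _ _), mul_comm (∫⁻ x, m.lr x ^ (-s) ∂m.postLaw),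
      ← lintegral_const_mul _ (by fun_prop), ← lintegral_const_mul _ (by fun_prop)]
    refine lintegral_mono_ae ?_
    filter_upwards [m.lr_ae_postLaw hI] with x hx
    rw [← ENNReal.mul_rpow_of_ne_zero h0 hx.1,
      lr_rpow_neg_eq (mul_ne_zero h0 hx.1) (ENNReal.mul_ne_top h1 hx.2), hmul x hx.1 hx.2,
      ← ENNReal.ofReal_mul (by positivity)]
    apply ENNReal.ofReal_le_ofReal
    refine max_le ?_ (by positivity)
    rw [inv_mul_eq_div, le_div_iff₀ hs]
    have := Real.add_one_le_exp (-(s * u x))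
    linarith
  have hlog : 0 ≤ Real.log w.toReal := Real.log_nonneg hw1
  rw [h2, h3, posLog_of_ne h0 h1]
  calc _ ≤ ENNReal.ofReal (Real.log w.toReal + m.klNumber.toReal)
        + ENNReal.ofReal (∫ x, max (-u x) 0 ∂m.postLaw) := ENNReal.ofReal_add_le
    _ ≤ _ := by
        rw [ENNReal.ofReal_add hlog ENNReal.toReal_nonneg, ENNReal.ofReal_toReal hI]
        gcongr

/-- A potential which dominates the CUSUM statistic of an affected sensor, and whose drift is at
most the Kullback-Leibler number. -/
theorem exists_post_potential (m : ChangeModel 𝓧) (hI0 : 0 < m.klNumber) (hI : m.klNumber ≠ ∞) :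
    ∃ (Q : ℝ≥0∞ → ℝ≥0∞) (c : ℝ), Measurable Q ∧ 0 ≤ c ∧ Q 1 ≤ ENNReal.ofReal c ∧
      (∀ w, posLog w ≤ Q w) ∧
      ∀ w, 1 ≤ w → ∫⁻ x, Q (max (w * m.lr x) 1) ∂m.postLaw ≤ Q w + m.klNumber := by
  have hlr := m.measurable_lr
  have hIpos : 0 < m.klNumber.toReal := ENNReal.toReal_pos hI0.ne' hI
  obtain ⟨s, hs0, hs1, hφ⟩ :=
    m.exists_lintegral_lr_rpow_neg_le hI (c := m.klNumber.toReal / 2) (by linarith)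
  set p := Real.exp (-(s * (m.klNumber.toReal / 2))) with hp
  have hp0 : 0 < p := Real.exp_pos _
  have hp1 : p < 1 := Real.exp_lt_one_iff.2 (by
    have : 0 < s * (m.klNumber.toReal / 2) := by positivity
    linarith)
  have h1p : 0 < 1 - p := by linarith
  replace hφ : ∫⁻ x, m.lr x ^ (-s) ∂m.postLaw ≤ ENNReal.ofReal p :=
    hφ.trans (ENNReal.ofReal_le_ofReal (by
      have := Real.add_one_le_exp (-(s * (m.klNumber.toReal / 2))); linarith))
  -- Solves `p / s + c p = c`: the decay of `c W^(-s)` exactly pays for the excess drift caused by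
  -- reflection.
  set c := p / (s * (1 - p)) with hc
  have hc0 : 0 ≤ c := by positivity
  have hplm := measurable_posLog
  refine ⟨fun w => posLog w + ENNReal.ofReal c * w ^ (-s), c, by fun_prop, hc0, ?_,
    fun w => le_self_add, fun w hw => ?_⟩
  · simp [posLog_one]
  · have h1 := m.lintegral_posLog_max_one_le hI hw hs0
    have h2 := m.lintegral_max_one_rpow_neg_le hI hw hs0.le
    rw [lintegral_add_left (by fun_prop), lintegral_const_mul _ (by fun_prop)]
    calc _ ≤ (posLog w + m.klNumber + ENNReal.ofReal s⁻¹ * (ENNReal.ofReal p * w ^ (-s)))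
          + ENNReal.ofReal c * (ENNReal.ofReal p * w ^ (-s)) := by
          refine add_le_add (h1.trans ?_) ?_
          · gcongr
          · exact mul_le_mul_right (h2.trans (by gcongr)) _
      _ = posLog w + m.klNumber
          + (ENNReal.ofReal s⁻¹ * ENNReal.ofReal p + ENNReal.ofReal c * ENNReal.ofReal p)
            * w ^ (-s) := by ring
      _ = posLog w + m.klNumber + ENNReal.ofReal c * w ^ (-s) := by
          rw [← ENNReal.ofReal_mul (by positivity), ← ENNReal.ofReal_mul hc0,
            ← ENNReal.ofReal_add (by positivity) (by positivity)]
          congr 3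
          rw [hc]; field_simp; ring
      _ = _ := by ring

theorem lintegral_mul_max_one_le (m : ChangeModel 𝓧) (hI : m.klNumber ≠ ∞) (ε w : ℝ≥0∞) :
    ∫⁻ x, ε * max (w * m.lr x) 1 ∂m.preLaw ≤ ε * w + ε := by
  have hlr := m.measurable_lr
  calc _ ≤ ∫⁻ x, (ε * (w * m.lr x) + ε) ∂m.preLaw := by
        refine lintegral_mono fun x => ?_
        rw [← mul_add_one]
        gcongr
        exact max_le le_self_add le_add_self
    _ = _ := by
        rw [lintegral_add_right _ measurable_const, lintegral_const_mul _ (by fun_prop),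
          lintegral_const_mul _ hlr, m.lintegral_lr hI]
        simp

theorem setLIntegral_expCusums_apply_succ_le_add (m : ChangeModel 𝓧) (κ : ℕ → ι → Measure 𝓧)
    [∀ i k, IsProbabilityMeasure (κ i k)] {t : ℕ} {A : Set (ℕ → ι → 𝓧)}
    (hA : MeasurableSet[past (ι → 𝓧) t] A) (k : ι) {ψ : ℝ≥0∞ → ℝ≥0∞} (hψ : Measurable ψ) (a : ℝ≥0∞)
    (ha : ∀ w, 1 ≤ w → ∫⁻ x, ψ (max (w * m.lr x) 1) ∂κ t k ≤ ψ w + a) :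
    ∫⁻ y in A, ψ (m.expCusums y (t + 1) k) ∂Measure.infinitePi (fun i => Measure.pi (κ i))
      ≤ ∫⁻ y in A, ψ (m.expCusums y t k) ∂Measure.infinitePi (fun i => Measure.pi (κ i))
        + a * Measure.infinitePi (fun i => Measure.pi (κ i)) A := by
  rw [m.setLIntegral_expCusums_apply_succ κ hA k hψ, ← setLIntegral_const,
    ← lintegral_add_right _ measurable_const]
  exact lintegral_mono fun y => ha _ (m.one_le_expCusum _ _)

end ChangeModel

/-! ### Adversaries and observations -/

theorem past_le_obsFiltration (𝓧 : Type*) [MeasurableSpace 𝓧] (K t : ℕ) :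
    past (Fin K → 𝓧) t ≤ obsFiltration 𝓧 K t := by
  refine iSup₂_le fun i hi => ?_
  have h1 : Measurable fun z : Fin t → Fin K → 𝓧 => z ⟨i, hi⟩ := measurable_pi_apply _
  have h2 := MeasurableSpace.comap_mono (g := fun (ω : ℕ → Fin K → 𝓧) (s : Fin t) => ω s)
    h1.comap_le
  rwa [MeasurableSpace.comap_comp] at h2

theorem measurable_observe_past {𝓧 : Type*} [MeasurableSpace 𝓧] {K : ℕ} {N : Finset (Fin K)}
    (π : Strategy 𝓧 N) (t : ℕ) :
    Measurable[past (N → 𝓧) t, obsFiltration 𝓧 K t] (observe π) := by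
  have h1 : Measurable[past (N → 𝓧) t] fun (y : ℕ → N → 𝓧) (s : Fin t) => observe π y s := by
    refine @measurable_pi_lambda _ _ _ (past (N → 𝓧) t) _ _ fun s => ?_
    refine @measurable_pi_lambda _ _ _ (past (N → 𝓧) t) _ _ fun k => ?_
    by_cases hk : k ∈ N
    · simp only [observe, hk, dite_true]
      exact (measurable_pi_apply (⟨k, hk⟩ : N)).comp (measurable_apply_past s.2)
    · simp only [observe, hk, dite_false]
      have h2 : Measurable[past (N → 𝓧) t]
          fun (y : ℕ → N → 𝓧) (j : Fin (s + 1)) => y j :=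
        @measurable_pi_lambda _ _ _ (past (N → 𝓧) t) _ _ fun j =>
          measurable_apply_past (lt_of_lt_of_le j.2 s.2)
      exact (measurable_pi_apply _).comp ((π.2 s).comp h2)
  rw [measurable_iff_comap_le] at h1 ⊢
  refine le_trans (le_of_eq ?_) h1
  exact MeasurableSpace.comap_comp

theorem MeasureTheory.condLExp_le_const_of_setLIntegral_le {Ω : Type*} {m m0 : MeasurableSpace Ω}
    (hm : m ≤ m0) (P : Measure Ω) [IsFiniteMeasure P] (X : Ω → ℝ≥0∞) (c : ℝ≥0∞)
    (h : ∀ A, MeasurableSet[m] A → ∫⁻ ω in A, X ω ∂P ≤ c * P A) :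
    condLExp m P X ≤ᵐ[P] fun _ => c := by
  refine ae_le_of_ae_le_trim (hm := hm) ?_
  refine ae_le_of_forall_setLIntegral_le_of_sigmaFinite (measurable_condLExp m P X)
    fun A hA _ => ?_
  rw [setLIntegral_trim hm (measurable_condLExp m P X) hA, setLIntegral_condLExp hm P X hA,
    setLIntegral_const, trim_measurableSet_eq hm hA]
  exact h A hA

namespace ChangeModel

variable {𝓧 : Type*} [MeasurableSpace 𝓧] {K : ℕ}

/-- The law of the observation of the honest sensor `k` at time `i + 1` when the change occurs at
time `ν` in the sensors of `B`. -/
def sensorLaw (m : ChangeModel 𝓧) (N B : Finset (Fin K)) (ν : ℕ∞) (i : ℕ) (k : N) : Measure 𝓧 :=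
  if (k : Fin K) ∈ B ∧ ν < ((i + 1 : ℕ) : ℕ∞) then m.postLaw else m.preLaw

instance (m : ChangeModel 𝓧) (N B : Finset (Fin K)) (ν : ℕ∞) (i : ℕ) (k : N) :
    IsProbabilityMeasure (m.sensorLaw N B ν i k) := by
  unfold sensorLaw; split_ifs <;> infer_instance

theorem honestLaw_eq (m : ChangeModel 𝓧) (N B : Finset (Fin K)) (ν : ℕ∞) :
    m.honestLaw N B ν = Measure.infinitePi fun i => Measure.pi (m.sensorLaw N B ν i) := rfl

instance (m : ChangeModel 𝓧) (N B : Finset (Fin K)) (ν : ℕ∞) :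
    IsProbabilityMeasure (m.honestLaw N B ν) := by
  rw [honestLaw_eq]; infer_instance

instance (m : ChangeModel 𝓧) (N B : Finset (Fin K)) (π : Strategy 𝓧 N) (ν : ℕ∞) :
    IsProbabilityMeasure (m.obsLaw N B π ν) :=
  Measure.isProbabilityMeasure_map (measurable_observe π).aemeasurable

theorem honestLaw_top (m : ChangeModel 𝓧) (N : Finset (Fin K)) :
    m.honestLaw N ∅ ⊤ = m.nullLaw N := by
  simp [honestLaw, nullLaw]

theorem expCusums_observe (m : ChangeModel 𝓧) {N : Finset (Fin K)} (π : Strategy 𝓧 N)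
    (y : ℕ → N → 𝓧) (t : ℕ) (k : N) :
    m.expCusums (observe π y) t k = m.expCusums y t k := by
  simp [expCusums, observe]

/-- The set `N` is one of the sets tested by the full rule, and its statistics are untouched by the
adversary. -/
theorem lowSumTime_le_lowSumTime_observe (m : ChangeModel 𝓧) {N : Finset (Fin K)}
    (π : Strategy 𝓧 N) (h : ℝ) (y : ℕ → N → 𝓧) :
    m.lowSumTime N.card h y ≤ m.lowSumTime N.card h (observe π y) := by
  have hc : N.card = Fintype.card N := (Fintype.card_coe N).symm
  have hle : N.card ≤ Fintype.card (Fin K) := Finset.card_le_univ N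
  by_contra hlt
  rw [not_le] at hlt
  obtain ⟨n, hn⟩ := ENat.ne_top_iff_exists.1 hlt.ne_top
  rw [← hn, hc, natCast_lt_lowSumTime_card_iff] at hlt
  refine absurd hn.ge (not_le.2 ((m.natCast_lt_lowSumTime_iff hle h _ n).2 fun t h1 h2 hcr => ?_))
  have h3 := hcr N rfl
  rw [← Finset.prod_coe_sort] at h3
  simp_rw [expCusums_observe] at h3
  exact absurd h3 (not_le.2 (hlt t h1 h2))

theorem isStoppingTime_lowSumTime (m : ChangeModel 𝓧) {L : ℕ} (hL : L ≤ K) (h : ℝ) :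
    IsStoppingTime (obsFiltration 𝓧 K) fun ω : ℕ → Fin K → 𝓧 => m.lowSumTime L h ω := by
  intro n
  have h1 := past_le_obsFiltration 𝓧 K n _
    (m.measurableSet_natCast_lt_lowSumTime_past (ι := Fin K) (by simpa using hL) h n)
  have h2 : {ω : ℕ → Fin K → 𝓧 | m.lowSumTime L h ω ≤ (n : ℕ∞)}
      = {ω | (n : ℕ∞) < m.lowSumTime L h ω}ᶜ := by
    ext ω; simp
  have h3 := h1.compl
  rw [← h2] at h3
  exact h3

theorem lowSumTime_mem_ruleClass (m : ChangeModel 𝓧) (N : Finset (Fin K)) {h γ : ℝ}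
    (hγ : ∫⁻ y, (m.lowSumTime N.card h y : ℝ≥0∞) ∂(m.honestLaw N ∅ ⊤) = ENNReal.ofReal γ) :
    (fun ω : ℕ → Fin K → 𝓧 => m.lowSumTime N.card h ω) ∈ m.ruleClass N γ := by
  have hle : N.card ≤ Fintype.card (Fin K) := Finset.card_le_univ N
  refine ⟨m.isStoppingTime_lowSumTime (by simpa using hle) h, le_iInf fun π => ?_⟩
  rw [obsLaw, lintegral_map (measurable_toENNReal _ (m.measurableSet_natCast_lt_lowSumTime hle h))
    (measurable_observe π), ← hγ]
  refine lintegral_mono fun y => ?_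
  exact ENat.toENNReal_le.2 (m.lowSumTime_le_lowSumTime_observe π h y)

theorem exists_worstDelay_le (m : ChangeModel 𝓧) (hI : m.klNumber ≠ ∞) {M : ℕ}
    {N B : Finset (Fin K)} (hN : N.card + M = K) (hBN : B ⊆ N) (hB : M + 1 ≤ B.card) {c : ℝ}
    (hc0 : 0 < c) (hc : c < m.klNumber.toReal) :
    ∃ C : ℝ, 0 ≤ C ∧ ∀ h : ℝ, 0 < h →
      m.worstDelay N B (fun ω : ℕ → Fin K → 𝓧 => m.lowSumTime N.card h ω)
        ≤ ENNReal.ofReal (h / ((B.card : ℝ) - M) / c + C) := by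
  classical
  set B' : Finset N := B.subtype (· ∈ N) with hB'
  obtain ⟨C, hC0, hC⟩ := m.exists_setLIntegral_delay_le hI hc0 hc B'.card
  refine ⟨C, hC0, fun h hh => ?_⟩
  set d : ℕ := B.card - M with hd
  have hdr : (B.card : ℝ) - M = d := by rw [hd, Nat.cast_sub (by omega)]
  have hd0 : (0 : ℝ) < d := by exact_mod_cast (by omega : 0 < d)
  have hle : N.card ≤ Fintype.card (Fin K) := Finset.card_le_univ N
  have hTm := m.measurableSet_natCast_lt_lowSumTime hle h
  rw [hdr]
  refine iSup₂_le fun ν π => essSup_le_of_ae_le _ ?_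
  refine condLExp_le_const_of_setLIntegral_le ((obsFiltration 𝓧 K).le ν) _ _ _ fun A hA => ?_
  have hobs := measurable_observe π
  have hA' := (obsFiltration 𝓧 K).le ν A hA
  have hX : Measurable fun ω : ℕ → Fin K → 𝓧 =>
      (m.lowSumTime N.card h ω : ℝ≥0∞) - ((ν : ℕ) : ℝ≥0∞) :=
    (measurable_toENNReal _ hTm).sub measurable_const
  rw [obsLaw, setLIntegral_map hA' hX hobs, Measure.map_apply hobs hA', honestLaw_eq]
  refine hC N (m.sensorLaw N B ν) B' ν (h / d) (fun y => m.lowSumTime N.card h (observe π y))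
    (observe π ⁻¹' A) le_rfl ?_ (by positivity) (fun n => hobs (hTm n))
    (measurable_observe_past π ν hA) ?_
  · intro i hi k hk
    rw [hB', Finset.mem_subtype] at hk
    rw [sensorLaw, if_pos ⟨hk, by exact_mod_cast Nat.lt_succ_of_le hi⟩]
  · intro n hn y hy
    have hncr := (m.natCast_lt_lowSumTime_iff hle h _ _).1 hy (ν + n) (by omega) le_rfl
    by_contra! hcon
    refine hncr fun J hJ => ?_
    -- Inclusion–exclusion: only `M` sensors lie outside `J`, so `J` misses at most `M` elements of
    -- `B`.
    have hJB : d ≤ (J ∩ B).card := by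
      have h1 := Finset.card_union_add_card_inter J B
      have h2 : (J ∪ B).card ≤ K := by simpa using Finset.card_le_univ (J ∪ B)
      omega
    have hW1 : ∀ k, 1 ≤ m.expCusums (observe π y) (ν + n) k := fun k => m.one_le_expCusum _ _
    have he1 : 1 ≤ ENNReal.ofReal (Real.exp (h / d)) := by
      rw [← ENNReal.ofReal_one]
      exact ENNReal.ofReal_le_ofReal (Real.one_le_exp (by positivity))
    calc ENNReal.ofReal (Real.exp h) = ENNReal.ofReal (Real.exp (h / d)) ^ d := by
          rw [← ENNReal.ofReal_pow (Real.exp_pos _).le, ← Real.exp_nat_mul]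
          congr 2
          field_simp
      _ ≤ ENNReal.ofReal (Real.exp (h / d)) ^ (J ∩ B).card := pow_le_pow_right₀ he1 hJB
      _ = ∏ k ∈ J ∩ B, ENNReal.ofReal (Real.exp (h / d)) := by rw [Finset.prod_const]
      _ ≤ ∏ k ∈ J ∩ B, m.expCusums (observe π y) (ν + n) k := by
          refine Finset.prod_le_prod' fun k hk => ?_
          have hkB := (Finset.mem_inter.1 hk).2
          have h3 := hcon ⟨k, hBN hkB⟩ (by rw [hB', Finset.mem_subtype]; exact hkB)
          rwa [← m.expCusums_observe π] at h3
      _ ≤ ∏ k ∈ J, m.expCusums (observe π y) (ν + n) k :=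
          Finset.prod_le_prod_of_subset_of_one_le' Finset.inter_subset_left fun k _ _ => hW1 k

/-- Change time `0` already suffices for the lower bound: an essential supremum of a conditional
mean dominates the mean. -/
theorem lintegral_le_worstDelay (m : ChangeModel 𝓧) (N B : Finset (Fin K)) (π : Strategy 𝓧 N)
    {T : (ℕ → Fin K → 𝓧) → ℕ∞} (hT : ∀ n : ℕ, MeasurableSet {ω | (n : ℕ∞) < T ω}) :
    ∫⁻ y, (T (observe π y) : ℝ≥0∞) ∂m.honestLaw N B (0 : ℕ) ≤ m.worstDelay N B T := by
  refine le_trans ?_ (le_iSup₂_of_le 0 π le_rfl)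
  rw [← lintegral_map (measurable_toENNReal T hT) (measurable_observe π)]
  simp only [Nat.cast_zero, tsub_zero]
  set P := m.obsLaw N B π ((0 : ℕ) : ℕ∞) with hP
  have h0 : m.obsLaw N B π 0 = P := by rw [hP, Nat.cast_zero]
  rw [h0]
  calc ∫⁻ ω, (T ω : ℝ≥0∞) ∂P
      = ∫⁻ ω, condLExp (obsFiltration 𝓧 K 0) P (fun ω => (T ω : ℝ≥0∞)) ω ∂P :=
        (lintegral_condLExp ((obsFiltration 𝓧 K).le 0) P _).symm
    _ ≤ ∫⁻ _, essSup (condLExp (obsFiltration 𝓧 K 0) P (fun ω => (T ω : ℝ≥0∞))) P ∂P :=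
        lintegral_mono_ae (ENNReal.ae_le_essSup _)
    _ = _ := by simp

theorem exists_le_mul_worstDelay (m : ChangeModel 𝓧) (hI0 : 0 < m.klNumber) (hI : m.klNumber ≠ ∞)
    {M : ℕ} {N B : Finset (Fin K)} (hN : N.card + M = K) (hBN : B ⊆ N) (hB : M + 1 ≤ B.card) {ε : ℝ}
    (hε : 0 < ε) :
    ∃ C : ℝ, ∀ h : ℝ, ENNReal.ofReal (h - C) ≤
      ENNReal.ofReal (((B.card : ℝ) - M) * m.klNumber.toReal + K * ε)
        * m.worstDelay N B (fun ω : ℕ → Fin K → 𝓧 => m.lowSumTime N.card h ω) := by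
  classical
  obtain ⟨Q, c, hQm, hc0, hQ1, hQlog, hQdrift⟩ := m.exists_post_potential hI0 hI
  obtain ⟨x₀, hx₀⟩ := m.exists_lr_le_one hI0 hI
  -- The complement of `D` has `K - M` sensors, so it is among the tested sets, yet it contains only
  -- `|B| - M` affected ones.
  obtain ⟨D, hDB, hDcard⟩ := Finset.exists_subset_card_eq (show M ≤ B.card by omega)
  set n₁ : ℝ := (N.card : ℝ)
  set C₁ : ℝ := |Real.log ε| with hC₁
  have hC₁0 : 0 ≤ C₁ := abs_nonneg _
  refine ⟨n₁ * C₁ + n₁ * (c + ε), fun h => ?_⟩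
  let π₀ : Strategy 𝓧 N := ⟨fun _ _ _ => x₀, fun _ => measurable_const⟩
  have hle : N.card ≤ Fintype.card (Fin K) := Finset.card_le_univ N
  have hTm := m.measurableSet_natCast_lt_lowSumTime hle h
  set τ : (ℕ → N → 𝓧) → ℕ∞ := fun y => m.lowSumTime N.card h (observe π₀ y) with hτdef
  have hτm : ∀ n : ℕ, MeasurableSet {y | (n : ℕ∞) < τ y} :=
    fun n => measurable_observe π₀ (hTm n)
  have hτpast : ∀ n : ℕ, MeasurableSet[past (N → 𝓧) n] {y | (n : ℕ∞) < τ y} := fun n =>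
    measurable_observe_past π₀ n (past_le_obsFiltration 𝓧 K n _
      (m.measurableSet_natCast_lt_lowSumTime_past hle h n))
  have hτ0 : ∀ y, 0 < τ y := fun y =>
    (m.natCast_lt_lowSumTime_iff hle h _ 0).2 fun t h1 h2 => by omega
  -- Per-sensor potentials: nothing on `D`, drift at most the information number on the rest of `B`,
  -- drift at most `ε` on the unaffected sensors.
  set q : Fin K → ℝ≥0∞ → ℝ≥0∞ := fun k w =>
    if k ∈ D then 0 else if k ∈ B then Q w else ENNReal.ofReal ε * w with hq
  set a : Fin K → ℝ≥0∞ := fun k =>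
    if k ∈ D then 0 else if k ∈ B then m.klNumber else ENNReal.ofReal ε with ha
  have hqm : ∀ k, Measurable (q k) := by
    intro k; simp only [hq]; split_ifs <;> fun_prop
  set Φ : ℕ → (ℕ → N → 𝓧) → ℝ≥0∞ := fun n y => ∑ k : N, q k (m.expCusums y n k) with hΦ
  set P := m.honestLaw N B (0 : ℕ) with hP
  have hWk : ∀ (n : ℕ) (k : N), Measurable fun y : ℕ → N → 𝓧 => m.expCusums y n k :=
    fun n k => (measurable_pi_apply k).comp (m.measurable_expCusums n)
  have hqW : ∀ (n : ℕ) (k : N), Measurable fun y : ℕ → N → 𝓧 => q k (m.expCusums y n k) :=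
    fun n k => (hqm k).comp (hWk n k)
  -- the corrupt sensors never accumulate evidence
  have hcorrupt : ∀ (y : ℕ → N → 𝓧) (n : ℕ) (k : Fin K), k ∉ N →
      m.expCusums (observe π₀ y) n k = 1 := by
    intro y n k hk
    induction n with
    | zero => rfl
    | succ n ih =>
      rw [expCusums_succ]
      beta_reduce
      rw [ih]
      simp only [observe, hk, dite_false, one_mul, π₀]
      exact max_eq_right hx₀
  have hstep : ∀ (n : ℕ) (k : N), ∫⁻ y in {y | (n : ℕ∞) < τ y}, q k (m.expCusums y (n + 1) k) ∂P
      ≤ ∫⁻ y in {y | (n : ℕ∞) < τ y}, q k (m.expCusums y n k) ∂P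
        + a k * P {y | (n : ℕ∞) < τ y} := by
    intro n k
    rw [hP, honestLaw_eq]
    refine m.setLIntegral_expCusums_apply_succ_le_add (m.sensorLaw N B (0 : ℕ)) (hτpast n) k
      (hqm k) (a k) fun w hw => ?_
    by_cases hkD : (k : Fin K) ∈ D
    · simp [hq, hkD]
    by_cases hkB : (k : Fin K) ∈ B
    · have hlaw : m.sensorLaw N B (0 : ℕ) n k = m.postLaw :=
        if_pos ⟨hkB, by exact_mod_cast n.succ_pos⟩
      simp only [hq, ha, hkD, hkB, if_true, if_false, hlaw]
      exact hQdrift w hw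
    · have hlaw : m.sensorLaw N B (0 : ℕ) n k = m.preLaw := if_neg fun h => hkB h.1
      simp only [hq, ha, hkD, hkB, if_false, hlaw]
      exact m.lintegral_mul_max_one_le hI _ w
  have hdrift : ∀ n : ℕ, ∫⁻ y in {y | (n : ℕ∞) < τ y}, Φ (n + 1) y ∂P
      ≤ ∫⁻ y in {y | (n : ℕ∞) < τ y}, Φ n y ∂P
        + (∑ k : N, a k) * P {y | (n : ℕ∞) < τ y} := by
    intro n
    simp only [hΦ]
    rw [lintegral_finsetSum _ fun k _ => hqW (n + 1) k, lintegral_finsetSum _ fun k _ => hqW n k,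
      Finset.sum_mul, ← Finset.sum_add_distrib]
    exact Finset.sum_le_sum fun k _ => hstep n k
  have hlogq : ∀ (k : Fin K) (w : ℝ≥0∞), k ∉ D → 1 ≤ w →
      posLog w ≤ q k w + ENNReal.ofReal C₁ := by
    intro k w hkD hw
    by_cases hkB : k ∈ B
    · simp only [hq, hkD, hkB, if_true, if_false]
      exact (hQlog w).trans le_self_add
    · simp only [hq, hkD, hkB, if_false]
      exact posLog_le_mul_add hw hε
  have hhit : ∀ (n : ℕ) y, (n : ℕ∞) < τ y → ¬ ((n + 1 : ℕ) : ℕ∞) < τ y →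
      ENNReal.ofReal (h - n₁ * C₁) ≤ Φ (n + 1) y := by
    intro n y h1 h2
    simp only [hτdef] at h1 h2
    rw [m.natCast_lt_lowSumTime_iff hle] at h1 h2
    push Not at h2
    obtain ⟨t, ht1, ht2, hcr⟩ := h2
    have htn : t = n + 1 := by
      by_contra hne
      exact h1 t ht1 (by omega) hcr
    subst htn
    have hJcard : (Finset.univ \ D).card = N.card := by
      rw [Finset.card_sdiff_of_subset (Finset.subset_univ D), Finset.card_univ, Fintype.card_fin]
      omega
    have h3 := hcr (Finset.univ \ D) hJcard
    have h4 : ∏ k ∈ Finset.univ \ D, m.expCusums (observe π₀ y) (n + 1) k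
        = ∏ k ∈ N \ D, m.expCusums (observe π₀ y) (n + 1) k := by
      refine (Finset.prod_subset (Finset.sdiff_subset_sdiff (Finset.subset_univ N) le_rfl)
        fun k hk hk' => hcorrupt y (n + 1) k fun hkN => hk' ?_).symm
      exact Finset.mem_sdiff.2 ⟨hkN, (Finset.mem_sdiff.1 hk).2⟩
    rw [h4] at h3
    have h5 : ENNReal.ofReal h ≤ Φ (n + 1) y + ENNReal.ofReal (n₁ * C₁) := by
      calc ENNReal.ofReal h
          ≤ posLog (∏ k ∈ N \ D, m.expCusums (observe π₀ y) (n + 1) k) := by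
            rw [← posLog_ofReal_exp]; exact posLog_mono h3
        _ ≤ ∑ k ∈ N \ D, posLog (m.expCusums (observe π₀ y) (n + 1) k) := posLog_prod_le _ _
        _ ≤ ∑ k ∈ N \ D, (q k (m.expCusums (observe π₀ y) (n + 1) k) + ENNReal.ofReal C₁) :=
            Finset.sum_le_sum fun k hk =>
              hlogq k _ (Finset.mem_sdiff.1 hk).2 (m.one_le_expCusum _ _)
        _ ≤ ∑ k ∈ N, (q k (m.expCusums (observe π₀ y) (n + 1) k) + ENNReal.ofReal C₁) :=
            Finset.sum_le_sum_of_subset Finset.sdiff_subset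
        _ = Φ (n + 1) y + ENNReal.ofReal (n₁ * C₁) := by
            rw [Finset.sum_add_distrib, Finset.sum_const, nsmul_eq_mul,
              ENNReal.ofReal_mul (Nat.cast_nonneg _), ENNReal.ofReal_natCast,
              ← Finset.sum_coe_sort]
            simp only [hΦ, expCusums_observe]
    rw [ENNReal.ofReal_sub _ (by positivity)]
    exact tsub_le_iff_right.2 h5
  have hasum : ∑ k : N, a k
      ≤ ENNReal.ofReal (((B.card : ℝ) - M) * m.klNumber.toReal + K * ε) := by
    have hBD : (B \ D).card = B.card - M := by rw [Finset.card_sdiff_of_subset hDB, hDcard]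
    have hNK : N.card ≤ K := by omega
    calc ∑ k : N, a k = ∑ k ∈ N, a k := Finset.sum_coe_sort N a
      _ ≤ ∑ k ∈ N, ((if k ∈ B \ D then m.klNumber else 0) + ENNReal.ofReal ε) := by
          refine Finset.sum_le_sum fun k _ => ?_
          simp only [ha, Finset.mem_sdiff]
          by_cases hkD : k ∈ D <;> by_cases hkB : k ∈ B <;> simp [hkD, hkB]
      _ = ((B \ D).card : ℝ≥0∞) * m.klNumber + N.card * ENNReal.ofReal ε := by
          rw [Finset.sum_add_distrib, Finset.sum_ite_mem,
            Finset.inter_eq_right.2 (Finset.sdiff_subset.trans hBN)]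
          simp
      _ ≤ ((B \ D).card : ℝ≥0∞) * m.klNumber + K * ENNReal.ofReal ε := by gcongr
      _ = _ := by
          have hcast : (B.card : ℝ) - M = ((B.card - M : ℕ) : ℝ) := by
            rw [Nat.cast_sub (by omega)]
          rw [hBD, hcast, ENNReal.ofReal_add (by positivity) (by positivity),
            ENNReal.ofReal_mul (by positivity), ENNReal.ofReal_mul (by positivity),
            ENNReal.ofReal_natCast, ENNReal.ofReal_natCast, ENNReal.ofReal_toReal hI]
  have hapos : ∑ k : N, a k ≠ 0 := by
    obtain ⟨k, hkB, hkD⟩ := Finset.exists_mem_notMem_of_card_lt_card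
      (show D.card < B.card by omega)
    refine (Finset.sum_pos_iff.2 ⟨⟨k, hBN hkB⟩, Finset.mem_univ _, ?_⟩).ne'
    simpa [ha, hkB, hkD] using hI0
  have hΦ0 : ∫⁻ y, Φ 0 y ∂P ≤ ENNReal.ofReal (n₁ * (c + ε)) := by
    have h1 : ∀ y, Φ 0 y ≤ ENNReal.ofReal (n₁ * (c + ε)) := by
      intro y
      calc Φ 0 y ≤ ∑ k : N, ENNReal.ofReal (c + ε) := by
            refine Finset.sum_le_sum fun k _ => ?_
            have hW0 : m.expCusums y 0 k = 1 := rfl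
            rw [hW0, ENNReal.ofReal_add hc0 hε.le]
            simp only [hq]
            split_ifs
            · exact zero_le
            · exact hQ1.trans le_self_add
            · rw [mul_one]; exact le_add_self
        _ = _ := by
            rw [Finset.sum_const, Finset.card_univ, Fintype.card_coe, nsmul_eq_mul,
              ENNReal.ofReal_mul (Nat.cast_nonneg _), ENNReal.ofReal_natCast]
    calc _ ≤ ∫⁻ _, ENNReal.ofReal (n₁ * (c + ε)) ∂P := lintegral_mono h1
      _ = _ := by simp
  have hmain := le_add_mul_lintegral_of_drift_le P hτm hτ0 Φ hapos ENNReal.ofReal_ne_top hhit hdrift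
  have hdelay := m.lintegral_le_worstDelay N B π₀ hTm
  rw [← sub_sub, ENNReal.ofReal_sub _ (by positivity)]
  refine tsub_le_iff_left.2 (hmain.trans ?_)
  gcongr

end ChangeModel

/-! ### First-order asymptotics -/

/-- Additive constants disappear because `x` tends to infinity; applying the bounds at the midpoint
between the target slope and `1` leaves room for them. -/
theorem tendsto_div_ofReal_one {α : Type*} {l : Filter α} {u : α → ℝ≥0∞} {x : α → ℝ}
    (hx : Tendsto x l atTop)
    (hup : ∀ b : ℝ, 1 < b → ∃ C : ℝ, ∀ᶠ i in l, u i ≤ ENNReal.ofReal (b * x i + C))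
    (hlow : ∀ a : ℝ, 0 < a → a < 1 → ∃ C : ℝ, ∀ᶠ i in l, ENNReal.ofReal (a * x i - C) ≤ u i) :
    Tendsto (fun i => u i / ENNReal.ofReal (x i)) l (𝓝 1) := by
  refine tendsto_order.2 ⟨fun a' ha' => ?_, fun b' hb' => ?_⟩
  · obtain ⟨a, ha0, ha1, ha2⟩ := ENNReal.lt_iff_exists_real_btwn.1 ha'
    have ha3 : a < 1 := by
      by_contra h
      rw [not_lt] at h
      exact absurd ha2 (not_lt.2 (by rw [← ENNReal.ofReal_one]; exact ENNReal.ofReal_le_ofReal h))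
    obtain ⟨C, hC⟩ := hlow ((a + 1) / 2) (by linarith) (by linarith)
    filter_upwards [hC, hx.eventually_ge_atTop (C / ((1 - a) / 2)), hx.eventually_gt_atTop 0]
      with i h1 h2 h3
    refine ha1.trans_le ?_
    rw [ENNReal.le_div_iff_mul_le (Or.inl (by simpa using h3)) (Or.inl ENNReal.ofReal_ne_top),
      ← ENNReal.ofReal_mul ha0]
    refine le_trans (ENNReal.ofReal_le_ofReal ?_) h1
    rw [div_le_iff₀ (by linarith)] at h2
    linarith
  · obtain ⟨b, hb0, hb1, hb2⟩ := ENNReal.lt_iff_exists_real_btwn.1 hb'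
    have hb3 : 1 < b := by
      by_contra h
      rw [not_lt] at h
      exact absurd hb1 (not_lt.2 (by rw [← ENNReal.ofReal_one]; exact ENNReal.ofReal_le_ofReal h))
    obtain ⟨C, hC⟩ := hup ((b + 1) / 2) (by linarith)
    filter_upwards [hC, hx.eventually_ge_atTop (C / ((b - 1) / 2)), hx.eventually_gt_atTop 0]
      with i h1 h2 h3
    refine lt_of_le_of_lt ?_ hb2
    rw [ENNReal.div_le_iff_le_mul (Or.inl (by simpa using h3)) (Or.inl ENNReal.ofReal_ne_top),
      ← ENNReal.ofReal_mul hb0]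
    refine h1.trans (ENNReal.ofReal_le_ofReal ?_)
    rw [div_le_iff₀ (by linarith)] at h2
    linarith

end

theorem mainTheorem2 {𝓧 : Type*} [MeasurableSpace 𝓧] (m : ChangeModel 𝓧)
    (hI_pos : 0 < m.klNumber) (hI_fin : m.klNumber < ∞)
    (K M : ℕ) (N : Finset (Fin K)) (hN : N.card + M = K)
    (Γ : Set ℝ) (hΓ : Γ ⊆ Ici 1) (h : ℝ → ℝ)
    (hh : ∀ γ ∈ Γ,
      ∫⁻ y, (m.lowSumTime (K - M) (h γ) y : ℝ≥0∞) ∂(m.honestLaw N ∅ ⊤) = ENNReal.ofReal γ) :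
    (∀ γ ∈ Γ, (fun ω : ℕ → Fin K → 𝓧 => m.lowSumTime (K - M) (h γ) ω) ∈ m.ruleClass N γ) ∧
    ∀ B ⊆ N, M + 1 ≤ B.card →
      Tendsto
        (fun γ : ℝ =>
          m.worstDelay N B (fun ω : ℕ → Fin K → 𝓧 => m.lowSumTime (K - M) (h γ) ω) /
            ENNReal.ofReal (Real.log γ / (((B.card : ℝ) - (M : ℝ)) * m.klNumber.toReal)))
        (atTop ⊓ 𝓟 Γ) (𝓝 1) := by
  have hL : K - M = N.card := by omega
  have hI := hI_fin.ne
  rw [hL] at hh ⊢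
  refine ⟨fun γ hγ => m.lowSumTime_mem_ruleClass N (hh γ hγ), fun B hBN hB => ?_⟩
  have hIr : 0 < m.klNumber.toReal := ENNReal.toReal_pos hI_pos.ne' hI
  have hcard : N.card = Fintype.card N := (Fintype.card_coe N).symm
  have hBN' := Finset.card_le_card hBN
  have : Nonempty N := Fintype.card_pos_iff.1 (by omega)
  have hnull : ∀ γ ∈ Γ, ∫⁻ y, (m.lowSumTime (Fintype.card N) (h γ) y : ℝ≥0∞) ∂m.nullLaw N
      = ENNReal.ofReal γ := by
    intro γ hγ
    rw [← m.honestLaw_top, ← hcard]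
    exact hh γ hγ
  -- A nonpositive threshold is crossed at time `1`, which is incompatible with a mean `γ > 1`.
  have hev : ∀ᶠ γ in atTop ⊓ 𝓟 Γ, γ ∈ Γ ∧ 1 < γ ∧ 0 < h γ := by
    filter_upwards [mem_inf_of_right (mem_principal_self Γ),
      mem_inf_of_left (Ioi_mem_atTop (1 : ℝ))] with γ hγ h1
    refine ⟨hγ, h1, ?_⟩
    by_contra hle
    have h2 := m.lintegral_lowSumTime_le_one N (not_lt.1 hle)
    rw [hnull γ hγ, ENNReal.ofReal_le_one] at h2
    exact absurd h1 (not_lt.2 h2)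
  set d : ℝ := (B.card : ℝ) - M with hd
  have hd0 : 0 < d := by
    have : ((M + 1 : ℕ) : ℝ) ≤ B.card := by exact_mod_cast hB
    push_cast at this
    linarith
  set I := m.klNumber.toReal
  have hdI : 0 < d * I := mul_pos hd0 hIr
  refine tendsto_div_ofReal_one ?_ ?_ ?_
  · exact (Real.tendsto_log_atTop.atTop_div_const hdI).mono_left inf_le_left
  · intro b hb
    have hb0 : 0 < b := by linarith
    -- The slack `b` is split evenly: one factor `1 / s` is lost in bounding `h` by `log γ`, another
    -- in taking the drift `s * I` instead of `I`.
    set s := Real.sqrt b⁻¹ with hs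
    have hs0 : 0 < s := Real.sqrt_pos.2 (by positivity)
    have hss : s * s = b⁻¹ := Real.mul_self_sqrt (by positivity)
    have hs1 : s < 1 := by
      have : b⁻¹ < 1 := inv_lt_one_of_one_lt₀ hb
      nlinarith
    obtain ⟨D, hD0, hD⟩ := m.exists_exp_le_mul_lintegral_lowSumTime hI_pos hI N hs0 hs1
    obtain ⟨C, hC0, hC⟩ := m.exists_worstDelay_le hI hN hBN hB (c := s * I) (by positivity)
      (by nlinarith)
    refine ⟨Real.log D / s / d / (s * I) + C, ?_⟩
    filter_upwards [hev] with γ hγ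
    obtain ⟨hγΓ, hγ1, hhγ⟩ := hγ
    have hγ0 : 0 < γ := by linarith
    have h1 := hD (h γ)
    rw [hnull γ hγΓ, ← ENNReal.ofReal_mul hD0.le,
      ENNReal.ofReal_le_ofReal_iff (by positivity)] at h1
    have h2 := Real.log_le_log (Real.exp_pos _) h1
    rw [Real.log_exp, Real.log_mul hD0.ne' hγ0.ne'] at h2
    refine (hC (h γ) hhγ).trans (ENNReal.ofReal_le_ofReal ?_)
    rw [← hd]
    have h3 : h γ ≤ (Real.log D + Real.log γ) / s := by
      rw [le_div_iff₀ hs0]; linarith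
    have h4 : h γ / d / (s * I) ≤ (Real.log D + Real.log γ) / s / d / (s * I) := by gcongr
    have hbs : b = (s * s)⁻¹ := by rw [hss, inv_inv]
    have h5 : (Real.log D + Real.log γ) / s / d / (s * I)
        = b * (Real.log γ / (d * I)) + Real.log D / s / d / (s * I) := by
      rw [hbs]; field_simp; ring
    linarith
  · intro a ha0 ha1
    set s := Real.sqrt a with hs
    have hs0 : 0 < s := Real.sqrt_pos.2 ha0
    have hss : s * s = a := Real.mul_self_sqrt ha0.le
    have hs1 : s < 1 := by nlinarith
    have hsinv : 1 < s⁻¹ := (one_lt_inv₀ hs0).2 hs1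
    have hK0 : (0 : ℝ) < K := by exact_mod_cast (by omega : 0 < K)
    -- With this `ε` the total drift `d I + K ε` equals `d I / s`; the other factor `s` of `a = s *
    -- s` comes from `1 + δ = s⁻¹`.
    have hε : 0 < (s⁻¹ - 1) * (d * I) / K := div_pos (mul_pos (by linarith) hdI) hK0
    obtain ⟨D, hD0, hD⟩ := m.exists_lintegral_lowSumTime_le hI_pos hI N (δ := s⁻¹ - 1) (by linarith)
    obtain ⟨C, hC⟩ := m.exists_le_mul_worstDelay hI_pos hI hN hBN hB hε
    refine ⟨(s * Real.log D + C) * s / (d * I), ?_⟩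
    filter_upwards [hev] with γ hγ
    obtain ⟨hγΓ, hγ1, hhγ⟩ := hγ
    have hγ0 : 0 < γ := by linarith
    have h1 := hD (h γ) hhγ
    rw [hnull γ hγΓ, ENNReal.ofReal_le_ofReal_iff (by positivity)] at h1
    have h2 := Real.log_le_log hγ0 h1
    rw [Real.log_mul hD0.ne' (Real.exp_pos _).ne', Real.log_exp, add_sub_cancel] at h2
    have h3 : s * (Real.log γ - Real.log D) ≤ h γ := by
      have h4 : s * (s⁻¹ * h γ) = h γ := by field_simp
      nlinarith
    have h5 := hC (h γ)
    have h6 : d * I + K * ((s⁻¹ - 1) * (d * I) / K) = d * I / s := by field_simp; ring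
    rw [← hd, h6, mul_comm] at h5
    have h7 : 0 < d * I / s := div_pos hdI hs0
    rw [← ENNReal.div_le_iff_le_mul (Or.inl (by simpa using h7)) (Or.inl ENNReal.ofReal_ne_top),
      ← ENNReal.ofReal_div_of_pos h7] at h5
    refine le_trans (ENNReal.ofReal_le_ofReal ?_) h5
    have h8 : (s * (Real.log γ - Real.log D) - C) / (d * I / s) ≤ (h γ - C) / (d * I / s) := by
      gcongr
    have h9 : (s * (Real.log γ - Real.log D) - C) / (d * I / s)
        = a * (Real.log γ / (d * I)) - (s * Real.log D + C) * s / (d * I) := by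
      rw [← hss]; field_simp; ring
    linarith
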